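/- Let $\Sigma$ be a (small, many-sorted, first-order) signature and let $\mathsf T$ be a cartesian theory in $\Sigma$. Here a regular formula is one built from atomic formulae (equations and relations) with $\top,\wedge,\exists$; a regular formula is cartesian over a set of sequents if each of its existential quantifiers is provably unique from these sequents in regular logic; and a cartesian theory is a set of sequents between regular formulae that carries a well-founded strict partial order such that both sides of each axiom are cartesian over the axioms that strictly precede it. Let $\mathrm{Mod}(\mathsf T)$ be the category of models of $\mathsf T$ and all homomorphisms of $\Sigma$-structures, and let $\mathcal T$ be the syntactic category of $\mathsf T$: its objects are the $[\vec x\mid\varphi]$ with $\varphi$ a cartesian formula (over $\mathsf T$) in the context $\vec x$, and its morphisms $[\vec x\mid\varphi]\to[\vec y\mid\psi]$ are the $\mathsf T$-provable equivalence classes of cartesian formulae $\theta(\vec x,\vec y)$ that are $\mathsf T$-provably functional from $\varphi$ to $\psi$. For a model $M$, let $[\![\vec x\mid\varphi]\!]_M$ be the set of tuples of $M$ that satisfy $\varphi$, and let $F_M(\theta):[\![\vec x\mid\varphi]\!]_M\to[\![\vec y\mid\psi]\!]_M$ be the function whose graph is defined by $\theta$. The finitely presentable model $\langle\vec x\mid\varphi\rangle$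 is the model corresponding to the representable functor $\mathcal T([\vec x\mid\varphi],-)$: its elements of sort $s$ are the morphisms $[\vec x\mid\varphi]\to[y:s\mid\top]$. A tuple $\vec a\in[\![\vec x\mid\varphi]\!]_M$ induces the homomorphism $\langle\vec x\mid\varphi\rangle\to M$, $\theta\mapsto F_M(\theta)(\vec a)$. For an atomic formula $\alpha$ in the context $\vec y$, let $\iota_\alpha:[\vec y\mid\alpha]\to[\vec y\mid\top]$ be the morphism given by $\alpha(\vec y)\wedge\vec y=\vec y'$, and let $\imath_\alpha:\langle\vec y\mid\top\rangle\to\langle\vec y\mid\alpha\rangle$ be the homomorphism that it induces by precomposition. (1) Let $\mathrm{At}$ be a set of atomic formulae-in-context. A homomorphism $h:N\to M$ in $\mathrm{Mod}(\mathsf T)$ is called $\mathrm{At}$-reflecting if for all $(\vec y,\alpha)\in\mathrm{At}$ and all tuples $\vec a$ of $N$ of the sorts of $\vec y$, $M\models\alpha(h(\vec a))$ implies $N\models\alpha(\vec a)$. Then $h$ is $\mathrm{At}$-reflecting if and only if for each $(\vec y,\alpha)\in\mathrm{At}$ and all homomorphisms $\ell:\langle\vec y\mid\top\rangle\to N$ and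 $k:\langle\vec y\mid\alpha\rangle\to M$ with $k\circ\imath_\alpha=h\circ\ell$ there is a homomorphism $d:\langle\vec y\mid\alpha\rangle\to N$ with $d\circ\imath_\alpha=\ell$. (2) For an object $[\vec x\mid\varphi]$ of $\mathcal T$, consider the $\mathcal L_\infty$-formula $$\mathrm{Emb}\langle\vec x\mid\varphi\rangle(\vec x)\;:=\;\bigwedge_{(\vec y,\alpha)\text{ atomic}}\ \bigwedge_{\theta\in\mathcal T([\vec x\mid\varphi],[\vec y\mid\top])}(\forall\vec y)\Bigl(\bigl(\alpha(\vec y)\wedge\theta(\vec x,\vec y)\bigr)\Rightarrow\bigvee_{\substack{\delta\in\mathcal T([\vec x\mid\varphi],[\vec y\mid\alpha])\\ \iota_\alpha\circ\delta=\theta}}\delta(\vec x,\vec y)\Bigr).$$ For every model $M$ of $\mathsf T$, every $\vec a\in[\![\vec x\mid\varphi]\!]_M$ and the homomorphism $h:\langle\vec x\mid\varphi\rangle\to M$ induced by $\vec a$: $h$ is an embedding of $\Sigma$-structures (that is, injective on each sort and reflecting all relations of $\Sigma$) if and only if $M\models\mathrm{Emb}\langle\vec x\mid\varphi\rangle(\vec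 a)$. -/

import Mathlib

open CategoryTheory

universe u v w

namespace CartLogic

/-! ### Contexts, variables, tuples -/

/-- `Var Γ s`: the variables of sort `s` declared in the context `Γ`.  A context is the list of the
sorts of its variables; variables are nameless, so renaming is built in.  A context extended by one
variable of sort `s` is `s :: Γ`, and `x⃗, y⃗` with `x⃗` in `Γ` and `y⃗` in `Δ` is `Δ ++ Γ`. -/
inductive Var {S : Type u} : List S → S → Type u
  | zero {Γ : List S} {s : S} : Var (s :: Γ) s
  | succ {Γ : List S} {s t : S} : Var Γ s → Var (t :: Γ) s

/-- A tuple of elements of the sorted family `A`, of the sorts listed in `Γ`. -/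
abbrev Tuple {S : Type u} (A : S → Type v) (Γ : List S) : Type (max u v) := ∀ s, Var Γ s → A s

section Tuples
variable {S : Type u} {A : S → Type v}

def Tuple.nil : Tuple A [] := fun _ v => nomatch v

def Tuple.cons {Γ : List S} {s : S} (x : A s) (a : Tuple A Γ) : Tuple A (s :: Γ)
  | _, .zero => x
  | _, .succ v => a _ v

def Tuple.tail {Γ : List S} {s : S} (a : Tuple A (s :: Γ)) : Tuple A Γ := fun _ v => a _ v.succ

/-- The concatenated tuple: `b` on the variables of `Δ`, `a` on those of `Γ`. -/
def Tuple.append {Γ : List S} : {Δ : List S} → Tuple A Δ → Tuple A Γ → Tuple A (Δ ++ Γ)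
  | [], _, a => a
  | _ :: _, b, a => Tuple.cons (b _ .zero) (Tuple.append b.tail a)

def Var.inl {Γ : List S} : {Δ : List S} → {s : S} → Var Δ s → Var (Δ ++ Γ) s
  | _ :: _, _, .zero => .zero
  | _ :: _, _, .succ v => .succ (Var.inl v)

def Var.inr {Γ : List S} : {Δ : List S} → {s : S} → Var Γ s → Var (Δ ++ Γ) s
  | [], _, v => v
  | _ :: _, _, v => .succ (Var.inr v)

def Tuple.map {B : S → Type w} (f : ∀ s, A s → B s) {Γ : List S} (a : Tuple A Γ) : Tuple B Γ :=
  fun s v => f s (a s v)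

theorem Tuple.cons_eta {Γ : List S} {s : S} (a : Tuple A (s :: Γ)) :
    Tuple.cons (a _ .zero) a.tail = a := by
  funext t v; cases v <;> rfl

theorem Tuple.nil_eq (a b : Tuple A []) : a = b := by
  funext t v; cases v

theorem Tuple.append_inl {Γ Δ : List S} (b : Tuple A Δ) (a : Tuple A Γ) {s : S} (v : Var Δ s) :
    Tuple.append b a s v.inl = b s v := by
  induction v with
  | zero => rfl
  | succ v ih => exact ih b.tail

theorem Tuple.append_inr {Γ Δ : List S} (b : Tuple A Δ) (a : Tuple A Γ) {s : S} (v : Var Γ s) :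
    Tuple.append b a s v.inr = a s v := by
  induction Δ with
  | nil => rfl
  | cons t Δ ih => exact ih b.tail

theorem Tuple.append_eta {Γ Δ : List S} (c : Tuple A (Δ ++ Γ)) :
    Tuple.append (fun _ v => c _ (Var.inl v)) (fun _ v => c _ (Var.inr v)) = c := by
  induction Δ with
  | nil => rfl
  | cons t Δ ih => exact (congrArg (Tuple.cons _) (ih c.tail)).trans c.cons_eta

theorem Tuple.map_cons {B : S → Type w} (f : ∀ s, A s → B s) {Γ : List S} {s : S} (x : A s)
    (a : Tuple A Γ) : (Tuple.cons x a).map f = Tuple.cons (f s x) (a.map f) := by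
  funext t v; cases v <;> rfl

end Tuples

/-! ### Signatures, terms, formulae -/

/-- A many-sorted signature. -/
structure Signature where
  Srt : Type u
  Fn : List Srt → Srt → Type u
  Rl : List Srt → Type u

variable {L : Signature.{u}}

/-- Terms-in-context. -/
inductive Term (L : Signature.{u}) (Γ : List L.Srt) : L.Srt → Type u
  | var {s : L.Srt} (v : Var Γ s) : Term L Γ s
  | app {d : List L.Srt} {s : L.Srt} (f : L.Fn d s) (ts : ∀ t, Var d t → Term L Γ t) : Term L Γ s

/-- Atomic formulae-in-context. -/
inductive Atom (L : Signature.{u}) (Γ : List L.Srt) : Type u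
  | eq {s : L.Srt} (t t' : Term L Γ s) : Atom L Γ
  | rel {d : List L.Srt} (R : L.Rl d) (ts : Tuple (Term L Γ) d) : Atom L Γ

/-- Formulae-in-context of regular logic: atomic formulae closed under finite conjunctions and
existential quantification.  The cartesian formulae are found among them. -/
inductive RForm (L : Signature.{u}) : List L.Srt → Type u
  | atom {Γ : List L.Srt} (α : Atom L Γ) : RForm L Γ
  | top {Γ : List L.Srt} : RForm L Γ
  | and {Γ : List L.Srt} (φ ψ : RForm L Γ) : RForm L Γ
  | ex {Γ : List L.Srt} {s : L.Srt} (φ : RForm L (s :: Γ)) : RForm L Γ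

/-- Formulae-in-context of the infinitary language `L_∞`. -/
inductive IForm (L : Signature.{u}) : List L.Srt → Type (u + 1)
  | atom {Γ : List L.Srt} (α : Atom L Γ) : IForm L Γ
  | neg {Γ : List L.Srt} (φ : IForm L Γ) : IForm L Γ
  | all {Γ : List L.Srt} {s : L.Srt} (φ : IForm L (s :: Γ)) : IForm L Γ
  | ex {Γ : List L.Srt} {s : L.Srt} (φ : IForm L (s :: Γ)) : IForm L Γ
  | conj {Γ : List L.Srt} {I : Type u} (φ : I → IForm L Γ) : IForm L Γ
  | disj {Γ : List L.Srt} {I : Type u} (φ : I → IForm L Γ) : IForm L Γ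

/-- Regular formulae as formulae of `L_∞`. -/
def RForm.toIForm : {Γ : List L.Srt} → RForm L Γ → IForm L Γ
  | _, .atom α => .atom α
  | _, .top => .conj (I := PEmpty) nofun
  | _, .and φ ψ => .conj (I := ULift Bool) fun b => if b.down then φ.toIForm else ψ.toIForm
  | _, .ex φ => .ex φ.toIForm

/-- Implication, as a formula of `L_∞`. -/
def IForm.imp {Γ : List L.Srt} (φ ψ : IForm L Γ) : IForm L Γ :=
  .disj (I := ULift Bool) fun b => if b.down then φ.neg else ψ

/-- `∀ y⃗, φ`, where `y⃗` are the variables of `Δ`. -/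
def IForm.alls {Γ : List L.Srt} : (Δ : List L.Srt) → IForm L (Δ ++ Γ) → IForm L Γ
  | [], φ => φ
  | _ :: Δ, φ => IForm.alls Δ (.all φ)

/-- `∃ y⃗, φ`, where `y⃗` are the variables of `Δ`. -/
def RForm.exs {Γ : List L.Srt} : (Δ : List L.Srt) → RForm L (Δ ++ Γ) → RForm L Γ
  | [], φ => φ
  | _ :: Δ, φ => RForm.exs Δ (.ex φ)

/-- The finite conjunction of a family of formulae indexed by the variables of `Δ`. -/
def RForm.conjVars {Γ : List L.Srt} :
    (Δ : List L.Srt) → (∀ s, Var Δ s → RForm L Γ) → RForm L Γ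
  | [], _ => .top
  | _ :: Δ, φ => .and (φ _ .zero) (RForm.conjVars Δ fun _ v => φ _ v.succ)

/-- The formula `t = t'`. -/
def RForm.eq {Γ : List L.Srt} {s : L.Srt} (t t' : Term L Γ s) : RForm L Γ := .atom (.eq t t')

/-- The formula `σ = τ` for tuples of terms. -/
def RForm.eqs {Γ Δ : List L.Srt} (σ τ : Tuple (Term L Γ) Δ) : RForm L Γ :=
  RForm.conjVars Δ fun s v => RForm.eq (σ s v) (τ s v)

/-! ### Substitution -/

def Term.subst {Γ Δ : List L.Srt} (σ : Tuple (Term L Δ) Γ) : {s : L.Srt} → Term L Γ s → Term L Δ s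
  | _, .var v => σ _ v
  | _, .app f ts => .app f fun t v => (ts t v).subst σ

/-- The substitution that renames variables along `r`. -/
def ren {Γ Δ : List L.Srt} (r : Tuple (Var Δ) Γ) : Tuple (Term L Δ) Γ := fun s v => .var (r s v)

/-- The substitution that adds a dummy variable to the context. -/
def wk {Γ : List L.Srt} {s : L.Srt} : Tuple (Term L (s :: Γ)) Γ := fun _ v => .var v.succ

/-- The variables of `Δ`, as terms in the context `Δ ++ Γ`. -/
def varsL {Δ Γ : List L.Srt} : Tuple (Term L (Δ ++ Γ)) Δ := fun _ v => .var v.inl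

/-- The variables of `Γ`, as terms in the context `Δ ++ Γ`. -/
def varsR {Δ Γ : List L.Srt} : Tuple (Term L (Δ ++ Γ)) Γ := fun _ v => .var v.inr

/-- Substitution under a binder. -/
def lift {Γ Δ : List L.Srt} {s : L.Srt} (σ : Tuple (Term L Δ) Γ) :
    Tuple (Term L (s :: Δ)) (s :: Γ) :=
  Tuple.cons (.var .zero) fun _ v => (σ _ v).subst wk

def Atom.subst {Γ Δ : List L.Srt} (σ : Tuple (Term L Δ) Γ) : Atom L Γ → Atom L Δ
  | .eq t t' => .eq (t.subst σ) (t'.subst σ)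
  | .rel R ts => .rel R fun s v => (ts s v).subst σ

def RForm.subst : {Γ : List L.Srt} → RForm L Γ → {Δ : List L.Srt} → Tuple (Term L Δ) Γ → RForm L Δ
  | _, .atom α, _, σ => .atom (α.subst σ)
  | _, .top, _, _ => .top
  | _, .and φ ψ, _, σ => .and (φ.subst σ) (ψ.subst σ)
  | _, .ex φ, _, σ => .ex (φ.subst (lift σ))

/-! ### Structures and satisfaction -/

/-- `L`-structures.  Sorts may be empty. -/
structure Str (L : Signature.{u}) where
  carrier : L.Srt → Type u
  fn : ∀ {d : List L.Srt} {s : L.Srt}, L.Fn d s → Tuple carrier d → carrier s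
  rl : ∀ {d : List L.Srt}, L.Rl d → Tuple carrier d → Prop

def Term.eval (M : Str L) {Γ : List L.Srt} (a : Tuple M.carrier Γ) :
    {s : L.Srt} → Term L Γ s → M.carrier s
  | _, .var v => a _ v
  | _, .app f ts => M.fn f fun t v => (ts t v).eval M a

def Atom.Sat (M : Str L) {Γ : List L.Srt} (a : Tuple M.carrier Γ) : Atom L Γ → Prop
  | .eq t t' => t.eval M a = t'.eval M a
  | .rel R ts => M.rl R fun s v => (ts s v).eval M a

def RForm.Sat (M : Str L) : {Γ : List L.Srt} → RForm L Γ → Tuple M.carrier Γ → Prop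
  | _, .atom α, a => α.Sat M a
  | _, .top, _ => True
  | _, .and φ ψ, a => φ.Sat M a ∧ ψ.Sat M a
  | _, .ex φ, a => ∃ x, φ.Sat M (Tuple.cons x a)

def IForm.Sat (M : Str L) : {Γ : List L.Srt} → IForm L Γ → Tuple M.carrier Γ → Prop
  | _, .atom α, a => α.Sat M a
  | _, .neg φ, a => ¬ φ.Sat M a
  | _, .all φ, a => ∀ x, φ.Sat M (Tuple.cons x a)
  | _, .ex φ, a => ∃ x, φ.Sat M (Tuple.cons x a)
  | _, .conj φ, a => ∀ i, (φ i).Sat M a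
  | _, .disj φ, a => ∃ i, (φ i).Sat M a

/-- Homomorphisms of structures. -/
@[ext] structure StrHom (M N : Str L) where
  toFun : ∀ s, M.carrier s → N.carrier s
  map_fn : ∀ {d : List L.Srt} {s : L.Srt} (f : L.Fn d s) (a : Tuple M.carrier d),
    toFun s (M.fn f a) = N.fn f (a.map toFun)
  map_rl : ∀ {d : List L.Srt} (R : L.Rl d) (a : Tuple M.carrier d),
    M.rl R a → N.rl R (a.map toFun)

/-- Embeddings of structures: sortwise injective homomorphisms that reflect the relations. -/
def StrHom.IsEmbedding {M N : Str L} (h : StrHom M N) : Prop :=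
  (∀ s, Function.Injective (h.toFun s)) ∧
    ∀ {d : List L.Srt} (R : L.Rl d) (a : Tuple M.carrier d), N.rl R (a.map h.toFun) → M.rl R a

/-! ### Theories, provability, cartesian theories -/

/-- A sequent `lhs ⊢_ctx rhs` of regular formulae. -/
structure Sequent (L : Signature.{u}) where
  ctx : List L.Srt
  lhs : RForm L ctx
  rhs : RForm L ctx

/-- `Provable T φ ψ`: the sequent `φ ⊢_Γ ψ` is derivable from the axioms `T` in regular logic. -/
inductive Provable (T : Set (Sequent L)) : {Γ : List L.Srt} → RForm L Γ → RForm L Γ → Prop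
  | ax (q : Sequent L) : q ∈ T → Provable T q.lhs q.rhs
  | id {Γ : List L.Srt} (φ : RForm L Γ) : Provable T φ φ
  | cut {Γ : List L.Srt} {φ ψ χ : RForm L Γ} : Provable T φ ψ → Provable T ψ χ → Provable T φ χ
  | subst {Γ Δ : List L.Srt} {φ ψ : RForm L Γ} (σ : Tuple (Term L Δ) Γ) :
      Provable T φ ψ → Provable T (φ.subst σ) (ψ.subst σ)
  | eq_refl {Γ : List L.Srt} {s : L.Srt} (t : Term L Γ s) : Provable T .top (.eq t t)
  | eq_subst {Γ Δ : List L.Srt} (φ : RForm L Γ) (σ τ : Tuple (Term L Δ) Γ) :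
      Provable T (.and (.eqs σ τ) (φ.subst σ)) (φ.subst τ)
  | top {Γ : List L.Srt} (φ : RForm L Γ) : Provable T φ .top
  | and_left {Γ : List L.Srt} (φ ψ : RForm L Γ) : Provable T (.and φ ψ) φ
  | and_right {Γ : List L.Srt} (φ ψ : RForm L Γ) : Provable T (.and φ ψ) ψ
  | and_intro {Γ : List L.Srt} {φ ψ χ : RForm L Γ} :
      Provable T φ ψ → Provable T φ χ → Provable T φ (.and ψ χ)
  | ex_left {Γ : List L.Srt} {s : L.Srt} {φ : RForm L (s :: Γ)} {ψ : RForm L Γ} :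
      Provable T φ (ψ.subst wk) → Provable T (.ex φ) ψ
  | ex_right {Γ : List L.Srt} {s : L.Srt} {φ : RForm L (s :: Γ)} {ψ : RForm L Γ} :
      Provable T (.ex φ) ψ → Provable T φ (ψ.subst wk)
  | frobenius {Γ : List L.Srt} {s : L.Srt} (φ : RForm L Γ) (ψ : RForm L (s :: Γ)) :
      Provable T (.and φ (.ex ψ)) (.ex (.and (φ.subst wk) ψ))

/-- The formula is cartesian over `T`: each existential quantifier in it is `T`-provably unique. -/
def RForm.IsCartesian (T : Set (Sequent L)) : {Γ : List L.Srt} → RForm L Γ → Prop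
  | _, .atom _ => True
  | _, .top => True
  | _, .and φ ψ => φ.IsCartesian T ∧ ψ.IsCartesian T
  | Γ, .ex (s := s) φ => φ.IsCartesian T ∧
      Provable T (Γ := s :: s :: Γ)
        (.and (φ.subst (Tuple.cons (.var .zero) fun _ v => .var v.succ.succ))
          (φ.subst (Tuple.cons (.var (.succ .zero)) fun _ v => .var v.succ.succ)))
        (.eq (.var .zero) (.var (.succ .zero)))

/-- A set of sequents is a cartesian theory when its axioms carry a well-founded strict partial
order such that both sides of each axiom are cartesian over the set of the preceding axioms. -/
def IsCartesianTheory (T : Set (Sequent L)) : Prop :=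
  ∃ r : T → T → Prop, IsTrans T r ∧ WellFounded r ∧
    ∀ q : T, q.1.lhs.IsCartesian {p | ∃ h : p ∈ T, r ⟨p, h⟩ q} ∧
      q.1.rhs.IsCartesian {p | ∃ h : p ∈ T, r ⟨p, h⟩ q}

/-- `M` is a model of the set of sequents `T`. -/
def Str.Models (M : Str L) (T : Set (Sequent L)) : Prop :=
  ∀ q ∈ T, ∀ a : Tuple M.carrier q.ctx, q.lhs.Sat M a → q.rhs.Sat M a

/-! ### Substitution lemmas and soundness -/

theorem Term.subst_subst {Γ Δ Θ : List L.Srt} (σ : Tuple (Term L Δ) Γ) (τ : Tuple (Term L Θ) Δ)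
    {s : L.Srt} (t : Term L Γ s) :
    (t.subst σ).subst τ = t.subst fun _ v => (σ _ v).subst τ := by
  induction t with
  | var v => rfl
  | app f ts ih => simp only [Term.subst, ih]

theorem Term.subst_var {Γ : List L.Srt} {s : L.Srt} (t : Term L Γ s) :
    t.subst (fun _ v => .var v) = t := by
  induction t with
  | var v => rfl
  | app f ts ih => simp only [Term.subst, ih]

theorem lift_comp {Γ Δ Θ : List L.Srt} {s : L.Srt} (σ : Tuple (Term L Δ) Γ)
    (τ : Tuple (Term L Θ) Δ) :
    (fun t (v : Var (s :: Γ) t) => (lift (s := s) σ t v).subst (lift τ)) =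
      lift fun _ v => (σ _ v).subst τ := by
  funext t v
  cases v with
  | zero => rfl
  | succ v => simp only [lift, Tuple.cons, Term.subst_subst]; rfl

theorem lift_var {Γ : List L.Srt} {s : L.Srt} :
    lift (s := s) (fun _ (v : Var Γ _) => Term.var (L := L) v) = fun _ v => .var v := by
  funext t v; cases v <;> rfl

theorem Atom.subst_subst {Γ Δ Θ : List L.Srt} (σ : Tuple (Term L Δ) Γ) (τ : Tuple (Term L Θ) Δ)
    (α : Atom L Γ) : (α.subst σ).subst τ = α.subst fun _ v => (σ _ v).subst τ := by
  cases α <;> simp only [Atom.subst, Term.subst_subst]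

theorem RForm.subst_subst {Γ Δ Θ : List L.Srt} (σ : Tuple (Term L Δ) Γ) (τ : Tuple (Term L Θ) Δ)
    (φ : RForm L Γ) : (φ.subst σ).subst τ = φ.subst fun _ v => (σ _ v).subst τ := by
  induction φ generalizing Δ Θ with
  | atom α => simp only [RForm.subst, Atom.subst_subst]
  | top => rfl
  | and φ ψ ih1 ih2 => simp only [RForm.subst, ih1, ih2]
  | ex φ ih => simp only [RForm.subst, ih, lift_comp]

theorem RForm.subst_var {Γ : List L.Srt} (φ : RForm L Γ) :
    φ.subst (fun _ v => .var v) = φ := by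
  induction φ with
  | atom α => cases α <;> simp only [RForm.subst, Atom.subst, Term.subst_var]
  | top => rfl
  | and φ ψ ih1 ih2 => simp only [RForm.subst, ih1, ih2]
  | ex φ ih => simp only [RForm.subst, lift_var, ih]

theorem Term.eval_subst (M : Str L) {Γ Δ : List L.Srt} (σ : Tuple (Term L Δ) Γ)
    (a : Tuple M.carrier Δ) {s : L.Srt} (t : Term L Γ s) :
    (t.subst σ).eval M a = t.eval M fun _ v => (σ _ v).eval M a := by
  induction t with
  | var v => rfl
  | app f ts ih => simp only [Term.subst, Term.eval, ih]

theorem eval_lift (M : Str L) {Γ Δ : List L.Srt} {s : L.Srt} (σ : Tuple (Term L Δ) Γ)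
    (a : Tuple M.carrier Δ) (x : M.carrier s) :
    (fun _ v => (lift (s := s) σ _ v).eval M (Tuple.cons x a)) =
      Tuple.cons x fun _ v => (σ _ v).eval M a := by
  funext t v
  cases v with
  | zero => rfl
  | succ v => exact Term.eval_subst M _ _ _

theorem Atom.sat_subst (M : Str L) {Γ Δ : List L.Srt} (σ : Tuple (Term L Δ) Γ)
    (a : Tuple M.carrier Δ) (α : Atom L Γ) :
    (α.subst σ).Sat M a ↔ α.Sat M fun _ v => (σ _ v).eval M a := by
  cases α <;> simp only [Atom.subst, Atom.Sat, Term.eval_subst]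

theorem RForm.sat_subst (M : Str L) {Γ Δ : List L.Srt} (σ : Tuple (Term L Δ) Γ)
    (a : Tuple M.carrier Δ) (φ : RForm L Γ) :
    (φ.subst σ).Sat M a ↔ φ.Sat M fun _ v => (σ _ v).eval M a := by
  induction φ generalizing Δ with
  | atom α => exact Atom.sat_subst M σ a α
  | top => rfl
  | and φ ψ ih1 ih2 => simp only [RForm.subst, RForm.Sat, ih1, ih2]
  | ex φ ih => simp only [RForm.subst, RForm.Sat, ih, eval_lift]

theorem RForm.sat_conjVars (M : Str L) {Γ : List L.Srt} (a : Tuple M.carrier Γ) (Δ : List L.Srt)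
    (φ : ∀ s, Var Δ s → RForm L Γ) :
    (RForm.conjVars Δ φ).Sat M a ↔ ∀ s v, (φ s v).Sat M a := by
  induction Δ with
  | nil => exact ⟨fun _ _ v => (nomatch v), fun _ => trivial⟩
  | cons t Δ ih =>
    refine ⟨fun h s v => ?_, fun h => ⟨h _ _, (ih _).2 fun s v => h _ _⟩⟩
    cases v with
    | zero => exact h.1
    | succ v => exact (ih _).1 h.2 _ v

theorem RForm.sat_eqs (M : Str L) {Γ Δ : List L.Srt} (σ τ : Tuple (Term L Γ) Δ)
    (a : Tuple M.carrier Γ) :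
    (RForm.eqs σ τ).Sat M a ↔ ∀ s v, (σ s v).eval M a = (τ s v).eval M a :=
  RForm.sat_conjVars M a Δ _

theorem RForm.sat_exs (M : Str L) {Γ Δ : List L.Srt} (φ : RForm L (Δ ++ Γ))
    (a : Tuple M.carrier Γ) :
    (RForm.exs Δ φ).Sat M a ↔ ∃ b : Tuple M.carrier Δ, φ.Sat M (b.append a) := by
  induction Δ with
  | nil => exact ⟨fun h => ⟨Tuple.nil, h⟩, fun ⟨_, h⟩ => h⟩
  | cons s Δ ih =>
    exact (ih _).trans ⟨fun ⟨b, x, h⟩ => ⟨Tuple.cons x b, h⟩, fun ⟨b, h⟩ => ⟨b.tail, b _ .zero, h⟩⟩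

theorem Provable.sound {T : Set (Sequent L)} {Γ : List L.Srt} {φ ψ : RForm L Γ}
    (h : Provable T φ ψ) (M : Str L) (hM : M.Models T) (a : Tuple M.carrier Γ)
    (ha : φ.Sat M a) : ψ.Sat M a := by
  induction h with
  | ax q hq => exact hM q hq a ha
  | id => exact ha
  | cut _ _ ih1 ih2 => exact ih2 a (ih1 a ha)
  | subst σ _ ih => exact (RForm.sat_subst ..).2 (ih _ ((RForm.sat_subst ..).1 ha))
  | eq_refl t => exact rfl
  | eq_subst φ σ τ =>
    refine (RForm.sat_subst ..).2 ?_
    have h := (RForm.sat_subst ..).1 ha.2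
    have e : (fun s v => (σ s v).eval M a) = fun s v => (τ s v).eval M a := by
      funext s v; exact (RForm.sat_eqs M σ τ a).1 ha.1 s v
    exact e ▸ h
  | top => trivial
  | and_left => exact ha.1
  | and_right => exact ha.2
  | and_intro _ _ ih1 ih2 => exact ⟨ih1 a ha, ih2 a ha⟩
  | ex_left _ ih =>
    obtain ⟨x, hx⟩ := ha
    exact (RForm.sat_subst ..).1 (ih _ hx)
  | ex_right _ ih =>
    refine (RForm.sat_subst ..).2 (ih _ ⟨a _ .zero, ?_⟩)
    exact (Tuple.cons_eta a).symm ▸ ha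
  | frobenius φ ψ =>
    obtain ⟨h1, x, hx⟩ := ha
    exact ⟨x, (RForm.sat_subst ..).2 h1, hx⟩

/-! ### Completeness of regular logic -/

namespace Henkin

/-- Formal witnesses. -/
inductive Wit (Γ₀ : List L.Srt) : L.Srt → Type u
  | gen {s : L.Srt} (v : Var Γ₀ s) : Wit Γ₀ s
  | wit {Δ : List L.Srt} {s : L.Srt} (ψ : RForm L (s :: Δ)) (args : ∀ t, Var Δ t → Wit Γ₀ t) :
      Wit Γ₀ s

variable (T : Set (Sequent L)) {Γ₀ : List L.Srt} (φ₀ : RForm L Γ₀)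

/-- Finite contexts obtained from `φ₀` by successively adding witnesses. -/
inductive Tower : (Θ : List L.Srt) → RForm L Θ → Tuple (Wit Γ₀) Θ → Prop
  | base : Tower Γ₀ φ₀ fun _ v => .gen v
  | step {Θ Δ : List L.Srt} {s : L.Srt} {δ : RForm L Θ} {e : Tuple (Wit Γ₀) Θ} (h : Tower Θ δ e)
      (ψ : RForm L (s :: Δ)) (r : Tuple (Var Θ) Δ)
      (hp : Provable T δ ((RForm.ex ψ).subst (ren r)))
      (fresh : ∀ v : Var Θ s, e _ v ≠ .wit ψ fun _ w => e _ (r _ w)) :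
      Tower (s :: Θ) (.and (δ.subst wk) (ψ.subst (lift (ren r))))
        (Tuple.cons (.wit ψ fun _ w => e _ (r _ w)) e)

variable {T φ₀}

theorem Tower.inj {Θ : List L.Srt} {δ : RForm L Θ} {e : Tuple (Wit Γ₀) Θ}
    (h : Tower T φ₀ Θ δ e) : ∀ {s} (v w : Var Θ s), e _ v = e _ w → v = w := by
  induction h with
  | base => intro s v w h; cases h; rfl
  | step h ψ r hp fresh ih =>
    intro t v w hvw
    cases v with
    | zero =>
      cases w with
      | zero => rfl
      | succ w => exact absurd hvw.symm (fresh w)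
    | succ v =>
      cases w with
      | zero => exact absurd hvw (fresh v)
      | succ w => exact congrArg _ (ih v w hvw)

theorem subst_ren_wk {Γ Θ : List L.Srt} {s : L.Srt} (χ : RForm L Γ) (r : Tuple (Var Θ) Γ) :
    (χ.subst (ren r)).subst (wk (s := s)) = χ.subst (ren fun _ v => .succ (r _ v)) := by
  rw [RForm.subst_subst]; rfl

theorem subst_ren_ren {Γ Δ Θ : List L.Srt} (χ : RForm L Γ) (r : Tuple (Var Δ) Γ)
    (r' : Tuple (Var Θ) Δ) :
    (χ.subst (ren r)).subst (ren r') = χ.subst (ren fun _ v => r' _ (r _ v)) := by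
  rw [RForm.subst_subst]; rfl

theorem subst_wk_ren {Γ Θ : List L.Srt} {s : L.Srt} (χ : RForm L Γ) (x : Var Θ s)
    (r : Tuple (Var Θ) Γ) :
    (χ.subst (wk (s := s))).subst (ren (Tuple.cons x r)) = χ.subst (ren r) := by
  rw [RForm.subst_subst]; rfl

theorem lift_ren {Γ Θ : List L.Srt} {s : L.Srt} (r : Tuple (Var Θ) Γ) :
    lift (s := s) (ren (L := L) r) = ren (Tuple.cons .zero fun _ v => .succ (r _ v)) := by
  funext t v; cases v <;> rfl

theorem Tower.gen {Θ : List L.Srt} {δ : RForm L Θ} {e : Tuple (Wit Γ₀) Θ}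
    (h : Tower T φ₀ Θ δ e) : ∃ r : Tuple (Var Θ) Γ₀, (∀ s v, e s (r s v) = .gen v) ∧
      Provable T δ (φ₀.subst (ren r)) ∧
      ∀ χ, Provable T δ (χ.subst (ren r)) → Provable T φ₀ χ := by
  induction h with
  | base =>
    refine ⟨fun _ v => v, fun _ _ => rfl, ?_, fun χ h => ?_⟩
    · exact (RForm.subst_var φ₀).symm ▸ Provable.id _
    · exact (RForm.subst_var χ) ▸ h
  | step h ψ r hp fresh ih =>
    obtain ⟨r0, h1, h2, h3⟩ := ih
    refine ⟨fun _ v => .succ (r0 _ v), h1, ?_, fun χ hχ => h3 χ ?_⟩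
    · rw [← subst_ren_wk]
      exact .cut (.and_left _ _) (.subst _ h2)
    · rw [← subst_ren_wk] at hχ
      exact .cut (.and_intro (.id _) hp) (.cut (.frobenius _ _) (.ex_left hχ))

theorem Tower.wit {Θ : List L.Srt} {δ : RForm L Θ} {e : Tuple (Wit Γ₀) Θ}
    (h : Tower T φ₀ Θ δ e) : ∀ {s} (v : Var Θ s) {Δ} (ψ : RForm L (s :: Δ)) (args),
      e _ v = .wit ψ args → ∃ r : Tuple (Var Θ) Δ, (∀ t w, e t (r t w) = args t w) ∧
        Provable T δ (ψ.subst (ren (Tuple.cons v r))) := by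
  induction h with
  | base => intro s v Δ ψ args h; cases h
  | @step Θ Δ₀ s₀ δ e h ψ r hp fresh ih =>
    intro t v Δ ψ' args hv
    cases v with
    | zero =>
      simp only [Tuple.cons] at hv
      cases hv
      refine ⟨fun _ w => .succ (r _ w), fun _ _ => rfl, ?_⟩
      rw [← lift_ren]
      exact .and_right _ _
    | succ v =>
      obtain ⟨r', h1, h2⟩ := ih v ψ' args hv
      refine ⟨fun _ w => .succ (r' _ w), h1, ?_⟩
      have : (Tuple.cons (v.succ) fun _ w => .succ (r' _ w) : Tuple (Var (s₀ :: Θ)) (t :: Δ)) =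
          fun s w => .succ (Tuple.cons v r' s w) := by
        funext s w; cases w <;> rfl
      rw [this, ← subst_ren_wk]
      exact .cut (.and_left _ _) (.subst _ h2)

theorem Tower.merge {Θ₁ : List L.Srt} {δ₁ : RForm L Θ₁} {e₁ : Tuple (Wit Γ₀) Θ₁}
    (h₁ : Tower T φ₀ Θ₁ δ₁ e₁) {Θ₂ : List L.Srt} {δ₂ : RForm L Θ₂} {e₂ : Tuple (Wit Γ₀) Θ₂}
    (h₂ : Tower T φ₀ Θ₂ δ₂ e₂) : ∃ Θ δ e, Tower T φ₀ Θ δ e ∧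
      (∃ r : Tuple (Var Θ) Θ₁, (∀ s v, e s (r s v) = e₁ s v) ∧ Provable T δ (δ₁.subst (ren r))) ∧
      ∃ r : Tuple (Var Θ) Θ₂, (∀ s v, e s (r s v) = e₂ s v) ∧
        Provable T δ (δ₂.subst (ren r)) := by
  induction h₂ with
  | base =>
    obtain ⟨r, hr, hr', -⟩ := h₁.gen
    exact ⟨_, _, _, h₁, ⟨fun _ v => v, fun _ _ => rfl, (RForm.subst_var δ₁).symm ▸ Provable.id _⟩,
      r, hr, hr'⟩
  | step h ψ r hp fresh ih =>
    rename_i Θ₂ Δ s δ₂ e₂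
    obtain ⟨Θ, δ, e, ht, ⟨r1, hr1, hp1⟩, r2, hr2, hp2⟩ := ih
    have hargs : (fun t w => e₂ t (r t w)) = fun t (w : Var Δ t) => e t (r2 t (r t w)) := by
      funext t w; exact (hr2 _ _).symm
    by_cases hx : ∃ v : Var Θ s, e _ v = .wit ψ fun _ w => e _ (r2 _ (r _ w))
    · obtain ⟨v, hv⟩ := hx
      obtain ⟨r', hr', hp'⟩ := ht.wit v ψ _ hv
      have hrr : r' = fun _ w => r2 _ (r _ w) := by
        funext t w; exact ht.inj _ _ (hr' t w)
      subst hrr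
      refine ⟨Θ, δ, e, ht, ⟨r1, hr1, hp1⟩, Tuple.cons v r2, ?_, ?_⟩
      · intro t w
        cases w with
        | zero => exact hv.trans (congrArg _ hargs.symm)
        | succ w => exact hr2 _ w
      · refine .and_intro ?_ ?_
        · rw [subst_wk_ren]; exact hp2
        · rw [lift_ren, subst_ren_ren]
          have : (fun t (w : Var (s :: Δ) t) => (Tuple.cons v r2) t
              ((Tuple.cons Var.zero fun _ v => Var.succ (r _ v) : Tuple (Var _) _) t w)) =
              Tuple.cons v fun _ w => r2 _ (r _ w) := by
            funext t w; cases w <;> rfl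
          rw [this]; exact hp'
    · have hp3 : Provable T δ ((RForm.ex ψ).subst (ren fun _ w => r2 _ (r _ w))) := by
        rw [← subst_ren_ren]
        exact .cut hp2 (.subst _ hp)
      have hs := Tower.step ht ψ (fun _ w => r2 _ (r _ w)) hp3 (fun v hv => hx ⟨v, hv⟩)
      refine ⟨_, _, _, hs, ⟨fun _ v => .succ (r1 _ v), hr1, ?_⟩,
        Tuple.cons .zero fun _ v => .succ (r2 _ v), ?_, ?_⟩
      · rw [← subst_ren_wk]; exact .cut (.and_left _ _) (.subst _ hp1)
      · intro t w
        cases w with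
        | zero => exact congrArg _ hargs.symm
        | succ w => exact hr2 _ w
      · refine .and_intro (.cut (.and_left _ _) ?_) (.cut (.and_right _ _) ?_)
        · rw [subst_wk_ren, ← subst_ren_wk]; exact .subst _ hp2
        · rw [lift_ren, lift_ren, subst_ren_ren]
          have : (fun t (w : Var (s :: Δ) t) =>
              (Tuple.cons Var.zero fun _ v => Var.succ (r2 _ v) : Tuple (Var _) _) t
              ((Tuple.cons Var.zero fun _ v => Var.succ (r _ v) : Tuple (Var _) _) t w)) =
              Tuple.cons (Var.zero) fun _ w => Var.succ (t := s) (r2 _ (r _ w)) := by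
            funext t w; cases w <;> rfl
          rw [this]; exact .id _

variable (T φ₀)

/-- The witnesses that occur in some tower. -/
def K (s : L.Srt) : Type u :=
  {h : Wit Γ₀ s // ∃ Θ δ e, Tower T φ₀ Θ δ e ∧ ∃ v : Var Θ s, e _ v = h}

variable {T φ₀}

/-- `χ` is forced at the tuple of witnesses `k`. -/
def Tr {Γ : List L.Srt} (χ : RForm L Γ) (k : Tuple (K T φ₀) Γ) : Prop :=
  ∃ Θ δ e, Tower T φ₀ Θ δ e ∧ ∃ r : Tuple (Var Θ) Γ, (∀ s v, e s (r s v) = (k s v).1) ∧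
    Provable T δ (χ.subst (ren r))

theorem Tr.mono {Γ : List L.Srt} {χ χ' : RForm L Γ} {k : Tuple (K T φ₀) Γ} (h : Tr χ k)
    (hp : Provable T χ χ') : Tr χ' k := by
  obtain ⟨Θ, δ, e, ht, r, hr, h⟩ := h
  exact ⟨Θ, δ, e, ht, r, hr, .cut h (.subst _ hp)⟩

theorem exists_tower {Γ : List L.Srt} (k : Tuple (K T φ₀) Γ) :
    ∃ Θ δ e, Tower T φ₀ Θ δ e ∧ ∃ r : Tuple (Var Θ) Γ, ∀ s v, e s (r s v) = (k s v).1 := by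
  induction Γ with
  | nil => exact ⟨_, _, _, .base, Tuple.nil, fun _ v => nomatch v⟩
  | cons s Γ ih =>
    obtain ⟨Θ₁, δ₁, e₁, h₁, r, hr⟩ := ih k.tail
    obtain ⟨Θ₂, δ₂, e₂, h₂, v, hv⟩ := (k _ .zero).2
    obtain ⟨Θ, δ, e, ht, ⟨r1, hr1, -⟩, r2, hr2, -⟩ := h₁.merge h₂
    refine ⟨Θ, δ, e, ht, Tuple.cons (r2 _ v) fun _ w => r1 _ (r _ w), fun t w => ?_⟩
    cases w with
    | zero => exact (hr2 _ _).trans hv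
    | succ w => exact (hr1 _ _).trans (hr _ w)

theorem Tr.and {Γ : List L.Srt} {χ χ' : RForm L Γ} {k : Tuple (K T φ₀) Γ} (h : Tr χ k)
    (h' : Tr χ' k) : Tr (.and χ χ') k := by
  obtain ⟨Θ₁, δ₁, e₁, h₁, r, hr, hp⟩ := h
  obtain ⟨Θ₂, δ₂, e₂, h₂, r', hr', hp'⟩ := h'
  obtain ⟨Θ, δ, e, ht, ⟨r1, hr1, hp1⟩, r2, hr2, hp2⟩ := h₁.merge h₂
  refine ⟨Θ, δ, e, ht, fun _ v => r1 _ (r _ v), fun s v => (hr1 _ _).trans (hr _ _), ?_⟩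
  have : (fun _ v => r2 _ (r' _ v) : Tuple (Var Θ) Γ) = fun _ v => r1 _ (r _ v) := by
    funext s v
    exact ht.inj _ _ ((hr2 _ _).trans ((hr' _ _).trans ((hr _ _).symm.trans (hr1 _ _).symm)))
  refine .and_intro ?_ ?_
  · rw [← subst_ren_ren]; exact .cut hp1 (.subst _ hp)
  · rw [← this, ← subst_ren_ren]; exact .cut hp2 (.subst _ hp')

theorem Tr.top {Γ : List L.Srt} (k : Tuple (K T φ₀) Γ) : Tr .top k := by
  obtain ⟨Θ, δ, e, ht, r, hr⟩ := exists_tower k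
  exact ⟨Θ, δ, e, ht, r, hr, .top _⟩

theorem Tr.ren_iff {Γ Δ : List L.Srt} (χ : RForm L Γ) (r : Tuple (Var Δ) Γ)
    (k : Tuple (K T φ₀) Δ) : Tr (χ.subst (ren r)) k ↔ Tr χ fun _ v => k _ (r _ v) := by
  constructor
  · rintro ⟨Θ, δ, e, ht, r1, hr1, hp⟩
    rw [subst_ren_ren] at hp
    exact ⟨Θ, δ, e, ht, _, fun s v => hr1 _ _, hp⟩
  · rintro ⟨Θ₂, δ₂, e₂, h₂, r', hr', hp'⟩
    obtain ⟨Θ₁, δ₁, e₁, h₁, r'', hr''⟩ := exists_tower k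
    obtain ⟨Θ, δ, e, ht, ⟨r1, hr1, hp1⟩, r2, hr2, hp2⟩ := h₁.merge h₂
    refine ⟨Θ, δ, e, ht, fun _ v => r1 _ (r'' _ v), fun s v => (hr1 _ _).trans (hr'' _ _), ?_⟩
    have : (fun _ v => r2 _ (r' _ v) : Tuple (Var Θ) Γ) = fun _ v => r1 _ (r'' _ (r _ v)) := by
      funext s v
      exact ht.inj _ _ ((hr2 _ _).trans ((hr' _ _).trans ((hr'' _ _).symm.trans (hr1 _ _).symm)))
    rw [subst_ren_ren, ← this, ← subst_ren_ren]
    exact .cut hp2 (.subst _ hp')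

theorem Tr.wk_iff {Γ : List L.Srt} {s : L.Srt} (χ : RForm L Γ) (d : K T φ₀ s)
    (k : Tuple (K T φ₀) Γ) : Tr (χ.subst wk) (Tuple.cons d k) ↔ Tr χ k :=
  Tr.ren_iff χ (fun _ v => .succ v) (Tuple.cons d k)

theorem provable_ex_intro {Γ : List L.Srt} {s : L.Srt} (ψ : RForm L (s :: Γ)) :
    Provable T ψ ((RForm.ex ψ).subst wk) := .ex_right (.id _)

theorem Tr.ex_iff {Γ : List L.Srt} {s : L.Srt} (ψ : RForm L (s :: Γ)) (k : Tuple (K T φ₀) Γ) :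
    Tr (.ex ψ) k ↔ ∃ d, Tr ψ (Tuple.cons d k) := by
  constructor
  · rintro ⟨Θ, δ, e, ht, r, hr, hp⟩
    have hk : ∀ {Θ' : List L.Srt} (e' : Tuple (Wit Γ₀) Θ') (v : Var Θ' s) (r' : Tuple (Var Θ') Γ)
        (d : K T φ₀ s), d.1 = e' _ v → (∀ t w, e' t (r' t w) = (k t w).1) →
        ∀ t w, e' t (Tuple.cons v r' t w) = (Tuple.cons d k t w).1 := by
      intro Θ' e' v r' d hd h t w
      cases w with
      | zero => exact hd.symm
      | succ w => exact h t w
    by_cases hx : ∃ v : Var Θ s, e _ v = .wit ψ fun _ w => e _ (r _ w)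
    · obtain ⟨v, hv⟩ := hx
      obtain ⟨r', hr', hp'⟩ := ht.wit v ψ _ hv
      exact ⟨⟨e _ v, Θ, δ, e, ht, v, rfl⟩, Θ, δ, e, ht, Tuple.cons v r',
        hk e v r' _ rfl fun t w => (hr' t w).trans (hr t w), hp'⟩
    · have hs := Tower.step ht ψ r hp (fun v hv => hx ⟨v, hv⟩)
      refine ⟨⟨_, _, _, _, hs, .zero, rfl⟩, _, _, _, hs, Tuple.cons .zero fun _ v => .succ (r _ v),
        hk _ _ _ _ rfl hr, ?_⟩
      rw [← lift_ren]
      exact .and_right _ _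
  · rintro ⟨d, h⟩
    exact (Tr.wk_iff _ d k).1 (h.mono (provable_ex_intro ψ))

theorem Tr.conjVars {Γ Δ : List L.Srt} (χ : ∀ s, Var Δ s → RForm L Γ) (k : Tuple (K T φ₀) Γ)
    (h : ∀ s v, Tr (χ s v) k) : Tr (.conjVars Δ χ) k := by
  induction Δ with
  | nil => exact Tr.top k
  | cons s Δ ih => exact (h _ _).and (ih _ fun _ v => h _ _)

theorem Tr.eq_subst {Γ Δ : List L.Srt} (χ : RForm L Δ) (σ τ : Tuple (Term L Γ) Δ)
    {k : Tuple (K T φ₀) Γ} (h : ∀ s v, Tr (.eq (σ s v) (τ s v)) k) (hχ : Tr (χ.subst σ) k) :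
    Tr (χ.subst τ) k :=
  ((Tr.conjVars _ k h).and hχ).mono (.eq_subst χ σ τ)

theorem Tr.refl {Γ : List L.Srt} {s : L.Srt} (t : Term L Γ s) (k : Tuple (K T φ₀) Γ) :
    Tr (.eq t t) k := (Tr.top k).mono (.eq_refl t)

theorem Tr.symm {Γ : List L.Srt} {s : L.Srt} {t u : Term L Γ s} {k : Tuple (K T φ₀) Γ}
    (h : Tr (.eq t u) k) : Tr (.eq u t) k := by
  have := Tr.eq_subst (k := k) (.eq (.var .zero) (.var (.succ .zero)) : RForm L [s, s])
    (Tuple.cons t (Tuple.cons t Tuple.nil)) (Tuple.cons u (Tuple.cons t Tuple.nil)) ?_ (Tr.refl t k)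
  · exact this
  · intro s v
    rcases v with _ | ⟨_ | v⟩
    · exact h
    · exact Tr.refl _ _
    · cases v

theorem Tr.trans {Γ : List L.Srt} {s : L.Srt} {t u w : Term L Γ s} {k : Tuple (K T φ₀) Γ}
    (h : Tr (.eq t u) k) (h' : Tr (.eq u w) k) : Tr (.eq t w) k := by
  have := Tr.eq_subst (k := k) (.eq (.var .zero) (.var (.succ .zero)) : RForm L [s, s])
    (Tuple.cons t (Tuple.cons u Tuple.nil)) (Tuple.cons t (Tuple.cons w Tuple.nil)) ?_ h
  · exact this
  · intro s v
    rcases v with _ | ⟨_ | v⟩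
    · exact Tr.refl _ _
    · exact h'
    · cases v

/-- Forced equality of witnesses. -/
def Eqv {s : L.Srt} (c d : K T φ₀ s) : Prop :=
  Tr (.eq (.var .zero) (.var (.succ .zero)) : RForm L [s, s])
    (Tuple.cons c (Tuple.cons d Tuple.nil))

theorem eqv_iff {Γ : List L.Srt} {s : L.Srt} (v w : Var Γ s) (k : Tuple (K T φ₀) Γ) :
    Tr (.eq (.var v) (.var w)) k ↔ Eqv (k _ v) (k _ w) := by
  have := Tr.ren_iff (.eq (.var .zero) (.var (.succ .zero)) : RForm L [s, s])
    (Tuple.cons v (Tuple.cons w Tuple.nil)) k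
  refine Iff.trans this (iff_of_eq (congrArg _ ?_))
  funext t x
  rcases x with _ | ⟨_ | x⟩
  · rfl
  · rfl
  · cases x

instance setoid (s : L.Srt) : Setoid (K T φ₀ s) where
  r := Eqv
  iseqv :=
    { refl := fun c => (eqv_iff .zero .zero (Tuple.cons c Tuple.nil)).1 (Tr.refl _ _)
      symm := fun {c d} h => (eqv_iff (.succ .zero) .zero
        (Tuple.cons c (Tuple.cons d Tuple.nil))).1 (Tr.symm h)
      trans := fun {c d f} h h' => by
        let k : Tuple (K T φ₀) [s, s, s] := Tuple.cons c (Tuple.cons d (Tuple.cons f Tuple.nil))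
        exact (eqv_iff .zero (.succ (.succ .zero)) k).1
          (Tr.trans ((eqv_iff .zero (.succ .zero) k).2 h)
            ((eqv_iff (.succ .zero) (.succ (.succ .zero)) k).2 h')) }

theorem Tr.congr {Γ : List L.Srt} (χ : RForm L Γ) (k k' : Tuple (K T φ₀) Γ)
    (h : ∀ s v, Eqv (k s v) (k' s v)) (hχ : Tr χ k) : Tr χ k' := by
  have h1 : Tr (χ.subst (ren fun _ v => v.inl)) (k.append k') := by
    rw [Tr.ren_iff]; simp only [Tuple.append_inl]; exact hχ
  have h2 : Tr (χ.subst (ren fun _ v => v.inr)) (k.append k') := by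
    refine Tr.eq_subst χ (ren fun _ v => v.inl) _ (fun s v => ?_) h1
    refine (eqv_iff _ _ _).2 ?_
    rw [Tuple.append_inl, Tuple.append_inr]; exact h s v
  rw [Tr.ren_iff] at h2; simp only [Tuple.append_inr] at h2; exact h2

theorem exists_fn {d : List L.Srt} {s : L.Srt} (f : L.Fn d s) (k : Tuple (K T φ₀) d) :
    ∃ e : K T φ₀ s, Tr (.eq (.app f fun _ v => .var v.succ) (.var .zero)) (Tuple.cons e k) := by
  rw [← Tr.ex_iff]
  have h : Provable T (RForm.top : RForm L d)
      ((RForm.ex (.eq (.app f fun _ v => .var v.succ) (.var .zero)) : RForm L d)) := by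
    have h1 := Provable.subst (T := T) (Tuple.cons (.app f fun _ v => .var v) fun _ v => .var v)
      (provable_ex_intro (T := T) (.eq (.app f fun _ v => .var v.succ) (.var .zero) :
        RForm L (s :: d)))
    rw [RForm.subst_subst] at h1
    refine .cut (Provable.eq_refl (T := T) (.app f fun _ v => .var v)) (.cut h1 ?_)
    have e := RForm.subst_var (RForm.ex (.eq (.app f fun _ v => .var v.succ) (.var .zero)) :
      RForm L d)
    exact Eq.mp (congrArg (Provable T _) e) (.id _)
  exact (Tr.top k).mono h

variable (T φ₀)

/-- The term model. -/
noncomputable def model : Str L where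
  carrier s := Quotient (setoid (T := T) (φ₀ := φ₀) s)
  fn f c := ⟦(exists_fn f fun _ v => (c _ v).out).choose⟧
  rl R c := Tr (.atom (.rel R fun _ v => .var v)) fun _ v => (c _ v).out

variable {T φ₀}

/-- The classes of a tuple of witnesses. -/
def cls {Γ : List L.Srt} (k : Tuple (K T φ₀) Γ) : Tuple (model T φ₀).carrier Γ :=
  k.map fun _ x => ⟦x⟧

theorem cls_out {Γ : List L.Srt} (c : Tuple (model T φ₀).carrier Γ) :
    cls (fun _ v => (c _ v).out) = c := by
  funext s v; exact Quotient.out_eq _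

theorem tr_eval {Γ : List L.Srt} {s : L.Srt} (t : Term L Γ s) (k : Tuple (K T φ₀) Γ) (d : K T φ₀ s)
    (h : ⟦d⟧ = t.eval (model T φ₀) (cls k)) :
    Tr (.eq (t.subst wk) (.var .zero)) (Tuple.cons d k) := by
  induction t with
  | var v => exact Tr.symm ((eqv_iff .zero v.succ (Tuple.cons d k)).2 (Quotient.exact h))
  | @app D s f ts ih =>
    let c : Tuple (K T φ₀) D := fun _ v => ((ts _ v).eval (model T φ₀) (cls k)).out
    have hc : ∀ t v, Tr (.eq ((ts t v).subst wk) (.var .zero)) (Tuple.cons (c t v) k) :=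
      fun t v => ih t v _ (Quotient.out_eq _)
    have hd : Eqv (exists_fn f c).choose d := Setoid.symm (Quotient.exact h)
    have h1 : Tr (.eq (.app f fun _ v => .var v.succ) (.var .zero)) (Tuple.cons d c) := by
      refine Tr.congr _ _ _ (fun t v => ?_) (exists_fn f c).choose_spec
      cases v with
      | zero => exact hd
      | succ v => exact (setoid _).iseqv.refl _
    let k' : Tuple (K T φ₀) (s :: (D ++ Γ)) := Tuple.cons d (c.append k)
    have h2 := (Tr.ren_iff (.eq (.app f fun _ v => .var v.succ) (.var .zero))
      (Tuple.cons .zero fun _ v => .succ v.inl) k').2 (by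
        convert h1 using 1
        funext t v
        cases v with
        | zero => rfl
        | succ v => exact Tuple.append_inl c k v)
    have h3 : ∀ t v, Tr (.eq ((ts t v).subst (ren fun _ w => .succ w.inr))
        (.var (.succ v.inl))) k' := fun t v => by
      have := (Tr.ren_iff (.eq ((ts t v).subst wk) (.var .zero))
        (Tuple.cons (.succ v.inl) fun _ w => .succ w.inr) k').2 (by
          convert hc t v using 1
          funext t w
          cases w with
          | zero => exact Tuple.append_inl c k v
          | succ v => exact Tuple.append_inr c k v)
      simp only [RForm.eq, RForm.subst, Atom.subst, Term.subst_subst] at this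
      exact this
    have h4 := Tr.eq_subst (k := k') (.eq (.app f fun _ v => .var v.succ) (.var .zero) :
        RForm L (s :: D)) (Tuple.cons (.var .zero) fun _ v => .var (.succ v.inl))
      (Tuple.cons (.var .zero) fun _ v => (ts _ v).subst (ren fun _ w => .succ w.inr)) (by
        intro t v
        cases v with
        | zero => exact Tr.refl _ _
        | succ v => exact Tr.symm (h3 _ v)) h2
    have h5 := (Tr.ren_iff (.eq ((Term.app f ts).subst wk) (.var .zero))
      (Tuple.cons .zero fun _ w => .succ w.inr) k').1 (by
        simp only [RForm.eq, RForm.subst, Atom.subst, Term.subst, Term.subst_subst] at h4 ⊢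
        exact h4)
    convert h5 using 1
    funext t v
    cases v with
    | zero => rfl
    | succ v => exact (Tuple.append_inr c k v).symm

theorem tr_eq_iff {Γ : List L.Srt} {s : L.Srt} (t u : Term L Γ s) (k : Tuple (K T φ₀) Γ) :
    t.eval (model T φ₀) (cls k) = u.eval (model T φ₀) (cls k) ↔ Tr (.eq t u) k := by
  let d := (t.eval (model T φ₀) (cls k)).out
  let d' := (u.eval (model T φ₀) (cls k)).out
  have hd : ⟦d⟧ = t.eval (model T φ₀) (cls k) := Quotient.out_eq _
  have hd' : ⟦d'⟧ = u.eval (model T φ₀) (cls k) := Quotient.out_eq _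
  have h1 := tr_eval t k d hd
  constructor
  · intro h
    have h2 := tr_eval u k d (hd.trans h)
    exact (Tr.wk_iff (.eq t u) d k).1 (h1.trans h2.symm)
  · intro h
    have h2 := tr_eval u k d' hd'
    have a1 := (Tr.ren_iff _ (Tuple.cons .zero fun _ v => .succ (.succ v))
      (Tuple.cons d (Tuple.cons d' k))).2 (by
        convert h1 using 1
        funext t v; cases v <;> rfl)
    have a2 := (Tr.wk_iff _ d (Tuple.cons d' k)).2 h2
    have a3 := (Tr.wk_iff _ d (Tuple.cons d' k)).2 ((Tr.wk_iff _ d' k).2 h)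
    simp only [RForm.eq, RForm.subst, Atom.subst, Term.subst_subst] at a1 a2 a3
    have := (eqv_iff .zero (.succ .zero) _).1 ((Tr.symm a1).trans (Tr.trans a3 a2))
    rw [← hd, ← hd']
    exact Quotient.sound this

theorem sat_iff {Γ : List L.Srt} (χ : RForm L Γ) (k : Tuple (K T φ₀) Γ) :
    χ.Sat (model T φ₀) (cls k) ↔ Tr χ k := by
  induction χ with
  | atom α =>
    cases α with
    | eq t u => exact tr_eq_iff t u k
    | @rel D R ts =>
      let c : Tuple (K T φ₀) D := fun _ v => ((ts _ v).eval (model T φ₀) (cls k)).out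
      have hc : ∀ t v, Tr (.eq ((ts t v).subst (ren fun _ w => w.inr)) (.var v.inl))
          (c.append k) := fun t v => by
        have := (Tr.ren_iff (.eq ((ts t v).subst wk) (.var .zero))
          (Tuple.cons v.inl fun _ w => w.inr) (c.append k)).2 (by
            convert tr_eval (ts t v) k (c t v) (Quotient.out_eq _) using 1
            funext t w
            cases w with
            | zero => exact Tuple.append_inl c k v
            | succ v => exact Tuple.append_inr c k v)
        simp only [RForm.eq, RForm.subst, Atom.subst, Term.subst_subst] at this
        exact this
      have e1 := Tr.ren_iff (.atom (.rel R fun _ v => .var v)) (fun _ v => v.inl) (c.append k)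
      have e2 := Tr.ren_iff (.atom (.rel R ts)) (fun _ v => v.inr) (c.append k)
      simp only [Tuple.append_inl, Tuple.append_inr] at e1 e2
      change Tr _ c ↔ _
      refine e1.symm.trans (Iff.trans ⟨fun h => ?_, fun h => ?_⟩ e2)
      · exact Tr.eq_subst (.atom (.rel R fun _ v => .var v)) (ren fun _ v => v.inl)
          (fun _ v => (ts _ v).subst (ren fun _ w => w.inr)) (fun t v => (hc t v).symm) h
      · exact Tr.eq_subst (.atom (.rel R fun _ v => .var v))
          (fun _ v => (ts _ v).subst (ren fun _ w => w.inr)) (ren fun _ v => v.inl) hc h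
  | top => exact ⟨fun _ => Tr.top k, fun _ => trivial⟩
  | and φ ψ ih1 ih2 =>
    refine ⟨fun h => ((ih1 k).1 h.1).and ((ih2 k).1 h.2), fun h => ⟨(ih1 k).2 ?_, (ih2 k).2 ?_⟩⟩
    · exact h.mono (.and_left _ _)
    · exact h.mono (.and_right _ _)
  | ex φ ih =>
    rw [Tr.ex_iff]
    constructor
    · rintro ⟨x, hx⟩
      refine ⟨x.out, (ih _).1 ?_⟩
      rw [cls, Tuple.map_cons]
      exact (congrArg (fun y => φ.Sat (model T φ₀) (Tuple.cons y (cls k)))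
        (Quotient.out_eq x)).mpr hx
    · rintro ⟨d, hd⟩
      refine ⟨⟦d⟧, ?_⟩
      have := (ih _).2 hd
      rw [cls, Tuple.map_cons] at this; exact this

theorem model_models : (model T φ₀).Models T := by
  intro q hq a h
  rw [← cls_out a] at h ⊢
  exact (sat_iff _ _).2 (((sat_iff _ _).1 h).mono (.ax q hq))

end Henkin

/-- Provability is validity in all models. -/
theorem provable_iff {T : Set (Sequent L)} {Γ : List L.Srt} {φ ψ : RForm L Γ} :
    Provable T φ ψ ↔ ∀ M : Str L, M.Models T → ∀ a : Tuple M.carrier Γ, φ.Sat M a → ψ.Sat M a := by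
  refine ⟨fun h M hM a => h.sound M hM a, fun h => ?_⟩
  let g : Tuple (Henkin.K T φ) Γ := fun _ v => ⟨.gen v, _, _, _, .base, v, rfl⟩
  have h1 : Henkin.Tr φ g :=
    ⟨_, _, _, .base, fun _ v => v, fun _ _ => rfl, (RForm.subst_var φ).symm ▸ Provable.id _⟩
  obtain ⟨Θ, δ, e, ht, r, hr, hp⟩ :=
    (Henkin.sat_iff ψ g).1 (h _ Henkin.model_models _ ((Henkin.sat_iff φ g).2 h1))
  obtain ⟨r', hr', -, h3⟩ := ht.gen
  have : r = r' := by
    funext s v; exact ht.inj _ _ ((hr s v).trans (hr' s v).symm)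
  exact h3 ψ (this ▸ hp)

theorem Tuple.append_map {S : Type u} {A : S → Type v} {B : S → Type w} (f : ∀ s, A s → B s)
    {Γ Δ : List S} (b : Tuple A Δ) (a : Tuple A Γ) :
    (fun s x => f s (Tuple.append b a s x)) =
      Tuple.append (fun s x => f s (b s x)) (fun s x => f s (a s x)) := by
  rw [← Tuple.append_eta (fun s x => f s (Tuple.append b a s x))]
  simp only [Tuple.append_inl, Tuple.append_inr]

theorem Tuple.append_inj {S : Type u} {A : S → Type v} {Γ Δ : List S} {b b' : Tuple A Δ}
    {a : Tuple A Γ} (h : Tuple.append b a = Tuple.append b' a) : b = b' := by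
  funext s x
  rw [← Tuple.append_inl b a x, h, Tuple.append_inl]

theorem RForm.isCartesian_ex_iff {T : Set (Sequent L)} {Γ : List L.Srt} {s : L.Srt}
    (φ : RForm L (s :: Γ)) : (RForm.ex φ).IsCartesian T ↔ φ.IsCartesian T ∧
      ∀ M : Str L, M.Models T → ∀ (a : Tuple M.carrier Γ) (x y : M.carrier s),
        φ.Sat M (Tuple.cons x a) → φ.Sat M (Tuple.cons y a) → x = y := by
  refine and_congr_right fun _ => provable_iff.trans ?_
  have e : ∀ (M : Str L) (c : Tuple M.carrier (s :: s :: Γ)) (z : Var (s :: s :: Γ) s),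
      (fun t (w : Var (s :: Γ) t) => ((Tuple.cons (.var z) fun _ v => .var v.succ.succ :
        Tuple (Term L (s :: s :: Γ)) (s :: Γ)) t w).eval M c) = Tuple.cons (c _ z) c.tail.tail := by
    intro M c z; funext t w; cases w <;> rfl
  constructor
  · intro h M hM a x y hx hy
    refine h M hM (Tuple.cons x (Tuple.cons y a)) ⟨?_, ?_⟩
    · exact (RForm.sat_subst ..).2 (by rw [e]; exact hx)
    · exact (RForm.sat_subst ..).2 (by rw [e]; exact hy)
  · intro h M hM c hc
    have h1 := (RForm.sat_subst ..).1 hc.1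
    have h2 := (RForm.sat_subst ..).1 hc.2
    rw [e] at h1 h2
    exact h M hM _ _ _ h1 h2

theorem RForm.IsCartesian.subst {T : Set (Sequent L)} {Γ Δ : List L.Srt} {φ : RForm L Γ}
    (h : φ.IsCartesian T) (σ : Tuple (Term L Δ) Γ) : (φ.subst σ).IsCartesian T := by
  induction φ generalizing Δ with
  | atom => trivial
  | top => trivial
  | and φ ψ ih1 ih2 => exact ⟨ih1 h.1 σ, ih2 h.2 σ⟩
  | ex φ ih =>
    rw [RForm.isCartesian_ex_iff] at h
    refine (RForm.isCartesian_ex_iff _).2 ⟨ih h.1 _, fun M hM a x y hx hy => ?_⟩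
    rw [RForm.sat_subst, eval_lift] at hx hy
    exact h.2 M hM _ x y hx hy

theorem RForm.isCartesian_exs {T : Set (Sequent L)} {Γ Δ : List L.Srt} (φ : RForm L (Δ ++ Γ))
    (h : φ.IsCartesian T) (hu : ∀ M : Str L, M.Models T → ∀ (a : Tuple M.carrier Γ)
      (b b' : Tuple M.carrier Δ), φ.Sat M (b.append a) → φ.Sat M (b'.append a) → b = b') :
    (RForm.exs Δ φ).IsCartesian T := by
  induction Δ with
  | nil => exact h
  | cons s Δ ih =>
    refine ih (.ex φ) ((RForm.isCartesian_ex_iff _).2 ⟨h, ?_⟩) ?_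
    · intro M hM c x y hx hy
      rw [← Tuple.append_eta c] at hx hy
      exact congrFun (congrFun (hu M hM _ (Tuple.cons x _) (Tuple.cons y _) hx hy) s) .zero
    · rintro M hM a b b' ⟨x, hx⟩ ⟨y, hy⟩
      exact congrArg Tuple.tail (hu M hM a (Tuple.cons x b) (Tuple.cons y b') hx hy)

theorem RForm.isCartesian_conjVars {T : Set (Sequent L)} {Γ Δ : List L.Srt}
    (φ : ∀ s, Var Δ s → RForm L Γ) (h : ∀ s v, (φ s v).IsCartesian T) :
    (RForm.conjVars Δ φ).IsCartesian T := by
  induction Δ with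
  | nil => trivial
  | cons s Δ ih => exact ⟨h _ _, ih _ fun s v => h _ _⟩

theorem Provable.mono {T T' : Set (Sequent L)} (hT : T ⊆ T') {Γ : List L.Srt} {φ ψ : RForm L Γ}
    (h : Provable T φ ψ) : Provable T' φ ψ :=
  provable_iff.2 fun M hM => h.sound M fun q hq => hM q (hT hq)

theorem RForm.IsCartesian.mono {T T' : Set (Sequent L)} (hT : T ⊆ T') {Γ : List L.Srt}
    {φ : RForm L Γ} (h : φ.IsCartesian T) : φ.IsCartesian T' := by
  induction φ with
  | atom => trivial
  | top => trivial
  | and φ ψ ih1 ih2 => exact ⟨ih1 h.1, ih2 h.2⟩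
  | ex φ ih => exact ⟨ih h.1, h.2.mono hT⟩

/-! ### The category of models -/

variable (L) in
/-- Cartesian theories in the signature `L`. -/
structure CartTheory where
  axioms : Set (Sequent L)
  isCartesian : IsCartesianTheory axioms

/-- The models of a cartesian theory. -/
structure Mdl (T : CartTheory L) where
  toStr : Str L
  models : toStr.Models T.axioms

/-- The category `Mod(T)`: models and all homomorphisms of structures. -/
instance (T : CartTheory L) : Category (Mdl T) where
  Hom M N := StrHom M.toStr N.toStr
  id M := ⟨fun _ x => x, fun _ _ => rfl, fun _ _ h => h⟩
  comp g h := ⟨fun s x => h.toFun s (g.toFun s x),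
    fun f a => (congrArg _ (g.map_fn f a)).trans (h.map_fn f _),
    fun R a hR => h.map_rl R _ (g.map_rl R a hR)⟩

/-! ### The syntactic category -/

/-- Objects of the syntactic category: formulae-in-context that are cartesian over the theory. -/
structure SynObj (T : CartTheory L) where
  ctx : List L.Srt
  form : RForm L ctx
  cart : form.IsCartesian T.axioms

variable {T : CartTheory L}

/-- `θ(x⃗, y⃗)` is a provably functional relation from `[x⃗ ∣ φ]` to `[y⃗ ∣ ψ]`. -/
structure IsFunctional (A B : SynObj T) (θ : RForm L (B.ctx ++ A.ctx)) : Prop where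
  /-- `θ` is cartesian over the theory -/
  cart : θ.IsCartesian T.axioms
  /-- `θ ⊢ φ ∧ ψ` -/
  typed : Provable T.axioms θ (.and (A.form.subst varsR) (B.form.subst varsL))
  /-- `θ ∧ θ[z⃗/y⃗] ⊢ z⃗ = y⃗` -/
  unique : Provable T.axioms (Γ := B.ctx ++ (B.ctx ++ A.ctx))
    (.and (θ.subst varsR) (θ.subst (Tuple.append varsL fun _ v => .var v.inr.inr)))
    (.eqs varsL fun _ v => .var v.inl.inr)
  /-- `φ ⊢ ∃ y⃗, θ` -/
  total : Provable T.axioms A.form (.exs B.ctx θ)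

/-- Provably functional relations, up to provable equivalence. -/
instance relSetoid (A B : SynObj T) : Setoid {θ // IsFunctional A B θ} where
  r θ θ' := Provable T.axioms θ.1 θ'.1 ∧ Provable T.axioms θ'.1 θ.1
  iseqv := ⟨fun _ => ⟨.id _, .id _⟩, fun h => ⟨h.2, h.1⟩,
    fun h h' => ⟨.cut h.1 h'.1, .cut h'.2 h.2⟩⟩

/-- Morphisms of the syntactic category. -/
def SynHom (A B : SynObj T) : Type u := Quotient (relSetoid A B)

/-- A formula that represents the morphism. -/
noncomputable def SynHom.rep {A B : SynObj T} (g : SynHom A B) : RForm L (B.ctx ++ A.ctx) :=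
  (Quotient.out g).1

theorem SynHom.rep_functional {A B : SynObj T} (g : SynHom A B) : IsFunctional A B g.rep :=
  (Quotient.out g).2

/-- The interpretation of `[x⃗ ∣ φ]` in a model. -/
def Mdl.interp (M : Mdl T) (A : SynObj T) : Type u :=
  {a : Tuple M.toStr.carrier A.ctx // A.form.Sat M.toStr a}

theorem eval_append (M : Str L) {Γ Δ Θ : List L.Srt} (σ : Tuple (Term L Θ) Δ)
    (τ : Tuple (Term L Θ) Γ) (e : Tuple M.carrier Θ) :
    (fun s v => (Tuple.append σ τ s v).eval M e) =
      Tuple.append (fun s v => (σ s v).eval M e) (fun s v => (τ s v).eval M e) :=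
  Tuple.append_map (fun _ t => Term.eval M e t) σ τ

theorem eval_varsL (M : Str L) {Γ Δ : List L.Srt} (b : Tuple M.carrier Δ) (a : Tuple M.carrier Γ) :
    (fun s v => (varsL (L := L) (Δ := Δ) (Γ := Γ) s v).eval M (b.append a)) = b := by
  funext s v; exact Tuple.append_inl b a v

theorem eval_varsR (M : Str L) {Γ Δ : List L.Srt} (b : Tuple M.carrier Δ) (a : Tuple M.carrier Γ) :
    (fun s v => (varsR (L := L) (Δ := Δ) (Γ := Γ) s v).eval M (b.append a)) = a := by
  funext s v; exact Tuple.append_inr b a v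

theorem isFunctional_iff {A B : SynObj T} {θ : RForm L (B.ctx ++ A.ctx)} :
    IsFunctional A B θ ↔ θ.IsCartesian T.axioms ∧ ∀ M : Mdl T,
      (∀ b a, θ.Sat M.toStr (Tuple.append b a) → A.form.Sat M.toStr a ∧ B.form.Sat M.toStr b) ∧
      ∀ a, A.form.Sat M.toStr a → ∃! b, θ.Sat M.toStr (Tuple.append b a) := by
  constructor
  · intro h
    refine ⟨h.cart, fun M => ⟨fun b a hba => ?_, fun a ha => ?_⟩⟩
    · have := h.typed.sound M.toStr M.models _ hba
      have h1 := (RForm.sat_subst ..).1 this.1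
      have h2 := (RForm.sat_subst ..).1 this.2
      rw [eval_varsR] at h1; rw [eval_varsL] at h2
      exact ⟨h1, h2⟩
    · obtain ⟨b, hb⟩ := (RForm.sat_exs ..).1 (h.total.sound M.toStr M.models a ha)
      refine ⟨b, hb, fun b' hb' => ?_⟩
      have := h.unique.sound M.toStr M.models (Tuple.append b' (Tuple.append b a)) ⟨?_, ?_⟩
      · funext s v
        have h1 := (RForm.sat_eqs ..).1 this s v
        simpa only [varsL, Term.eval, Tuple.append_inl, Tuple.append_inr] using h1
      · rw [RForm.sat_subst, eval_varsR]; exact hb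
      · rw [RForm.sat_subst, eval_append, eval_varsL]
        simp only [Term.eval, Tuple.append_inr]; exact hb'
  · rintro ⟨hc, h⟩
    refine ⟨hc, provable_iff.2 fun M hM c hb => ?_, provable_iff.2 fun M hM c hc => ?_,
      provable_iff.2 fun M hM a ha => ?_⟩
    · rw [← Tuple.append_eta c] at hb ⊢
      have := (h ⟨M, hM⟩).1 _ _ hb
      refine ⟨(RForm.sat_subst ..).2 ?_, (RForm.sat_subst ..).2 ?_⟩
      · rw [eval_varsR]; exact this.1
      · rw [eval_varsL]; exact this.2
    · rw [← Tuple.append_eta c] at hc ⊢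
      generalize (fun s (v : Var B.ctx s) => c s v.inl) = b' at hc ⊢
      generalize (fun s (v : Var (B.ctx ++ A.ctx) s) => c s v.inr) = d at hc ⊢
      rw [← Tuple.append_eta d] at hc ⊢
      generalize (fun s (v : Var B.ctx s) => d s v.inl) = b at hc ⊢
      generalize (fun s (v : Var A.ctx s) => d s v.inr) = a at hc ⊢
      have h1 := hc.1
      have h2 := hc.2
      rw [RForm.sat_subst, eval_varsR] at h1
      rw [RForm.sat_subst, eval_append, eval_varsL] at h2
      simp only [Term.eval, Tuple.append_inr] at h2
      have ha := ((h ⟨M, hM⟩).1 _ _ h1).1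
      have := ((h ⟨M, hM⟩).2 a ha).unique h2 h1
      refine (RForm.sat_eqs ..).2 fun s v => ?_
      simp only [varsL, Term.eval, Tuple.append_inl, Tuple.append_inr, this]
    · obtain ⟨b, hb, -⟩ := (h ⟨M, hM⟩).2 a ha
      exact (RForm.sat_exs ..).2 ⟨b, hb⟩

/-- The functor `F_M` on morphisms: the function `⟦A⟧_M → ⟦B⟧_M` whose graph is the interpretation
of the functional relation. -/
noncomputable def SynHom.app {A B : SynObj T} (g : SynHom A B) (M : Mdl T) (a : M.interp A) :
    M.interp B :=
  ⟨(((isFunctional_iff.1 g.rep_functional).2 M).2 a.1 a.2).choose,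
    (((isFunctional_iff.1 g.rep_functional).2 M).1 _ _
      (((isFunctional_iff.1 g.rep_functional).2 M).2 a.1 a.2).choose_spec.1).2⟩

theorem SynHom.app_iff {A B : SynObj T} (g : SynHom A B) (M : Mdl T) (a : M.interp A)
    (b : Tuple M.toStr.carrier B.ctx) :
    g.rep.Sat M.toStr (Tuple.append b a.1) ↔ (g.app M a).1 = b := by
  have h := (((isFunctional_iff.1 g.rep_functional).2 M).2 a.1 a.2)
  constructor
  · intro hb; exact (h.choose_spec.2 b hb).symm
  · rintro rfl; exact h.choose_spec.1

theorem SynHom.rep_mk {A B : SynObj T} (θ : {θ // IsFunctional A B θ}) (M : Mdl T)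
    (c : Tuple M.toStr.carrier (B.ctx ++ A.ctx)) :
    (SynHom.rep (A := A) (B := B) ⟦θ⟧).Sat M.toStr c ↔ θ.1.Sat M.toStr c := by
  have h : Provable T.axioms (Quotient.out (⟦θ⟧ : Quotient (relSetoid A B))).1 θ.1 ∧
    Provable T.axioms θ.1 (Quotient.out (⟦θ⟧ : Quotient (relSetoid A B))).1 :=
    Quotient.exact (s := relSetoid A B) (Quotient.out_eq _)
  exact ⟨h.1.sound M.toStr M.models c, h.2.sound M.toStr M.models c⟩

theorem SynHom.app_mk {A B : SynObj T} (θ : {θ // IsFunctional A B θ}) (M : Mdl T)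
    (a : M.interp A) (b : Tuple M.toStr.carrier B.ctx)
    (h : θ.1.Sat M.toStr (Tuple.append b a.1)) :
    (SynHom.app (A := A) (B := B) ⟦θ⟧ M a).1 = b :=
  (SynHom.app_iff ..).1 ((SynHom.rep_mk ..).2 h)

theorem SynHom.ext_app {A B : SynObj T} {g g' : SynHom A B}
    (h : ∀ (M : Mdl T) (a : M.interp A), (g.app M a).1 = (g'.app M a).1) : g = g' := by
  have key : ∀ g g' : SynHom A B, (∀ (M : Mdl T) (a : M.interp A),
      (g.app M a).1 = (g'.app M a).1) → Provable T.axioms g.rep g'.rep := by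
    intro g g' h
    refine provable_iff.2 fun M hM c hc => ?_
    rw [← Tuple.append_eta c] at hc ⊢
    have ha := (((isFunctional_iff.1 g.rep_functional).2 ⟨M, hM⟩).1 _ _ hc).1
    exact (g'.app_iff ⟨M, hM⟩ ⟨_, ha⟩ _).2
      ((h ⟨M, hM⟩ ⟨_, ha⟩).symm.trans ((g.app_iff ⟨M, hM⟩ ⟨_, ha⟩ _).1 hc))
  rw [← Quotient.out_eq g, ← Quotient.out_eq g']
  exact Quotient.sound ⟨key _ _ h, key _ _ fun M a => (h M a).symm⟩

/-- The identity: `φ(x⃗) ∧ x⃗ = y⃗`. -/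
def idForm (A : SynObj T) : RForm L (A.ctx ++ A.ctx) :=
  .and (A.form.subst varsR) (.eqs varsR varsL)

theorem idForm_sat (A : SynObj T) (M : Str L) (b a : Tuple M.carrier A.ctx) :
    (idForm A).Sat M (b.append a) ↔ A.form.Sat M a ∧ a = b := by
  refine and_congr ((RForm.sat_subst ..).trans (by rw [eval_varsR]))
    ((RForm.sat_eqs ..).trans ?_)
  simp only [varsL, varsR, Term.eval, Tuple.append_inl, Tuple.append_inr]
  exact ⟨fun h => funext fun s => funext fun v => h s v, fun h s v => by rw [h]⟩

theorem idForm_cart (A : SynObj T) : (idForm A).IsCartesian T.axioms :=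
  ⟨A.cart.subst _, RForm.isCartesian_conjVars _ fun _ _ => trivial⟩

/-- The composite: `∃ y⃗, θ(x⃗, y⃗) ∧ ρ(y⃗, z⃗)`. -/
noncomputable def compForm {A B C : SynObj T} (g : SynHom A B) (h : SynHom B C) :
    RForm L (C.ctx ++ A.ctx) :=
  .exs B.ctx (.and (g.rep.subst (Tuple.append varsL fun _ v => .var v.inr.inr))
    (h.rep.subst (Tuple.append (fun _ v => .var v.inl.inr) varsL)))

theorem compBody_sat {A B C : SynObj T} (g : SynHom A B) (h : SynHom B C) (M : Str L)
    (c : Tuple M.carrier C.ctx) (b : Tuple M.carrier B.ctx) (a : Tuple M.carrier A.ctx) :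
    (RForm.and (g.rep.subst (Tuple.append varsL fun _ v => .var v.inr.inr))
      (h.rep.subst (Tuple.append (fun _ v => .var v.inl.inr) varsL))).Sat M
        (b.append (c.append a)) ↔ g.rep.Sat M (b.append a) ∧ h.rep.Sat M (c.append b) := by
  refine and_congr ?_ ?_
  · rw [RForm.sat_subst, eval_append, eval_varsL]
    simp only [Term.eval, Tuple.append_inr]
  · rw [RForm.sat_subst, eval_append, eval_varsL]
    simp only [Term.eval, Tuple.append_inr, Tuple.append_inl]

theorem compForm_sat {A B C : SynObj T} (g : SynHom A B) (h : SynHom B C) (M : Mdl T)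
    (a : M.interp A) (c : Tuple M.toStr.carrier C.ctx) :
    (compForm g h).Sat M.toStr (c.append a.1) ↔ (h.app M (g.app M a)).1 = c := by
  refine (RForm.sat_exs ..).trans ?_
  simp only [compBody_sat, SynHom.app_iff]
  constructor
  · rintro ⟨b, rfl, hb⟩; exact (SynHom.app_iff ..).1 hb
  · intro hc; exact ⟨_, rfl, (SynHom.app_iff ..).2 hc⟩

theorem compForm_functional {A B C : SynObj T} (g : SynHom A B) (h : SynHom B C) :
    IsFunctional A C (compForm g h) := by
  refine isFunctional_iff.2 ⟨?_, fun M => ⟨fun c a hca => ?_, fun a ha => ?_⟩⟩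
  · refine RForm.isCartesian_exs _ ⟨g.rep_functional.cart.subst _, h.rep_functional.cart.subst _⟩ ?_
    intro M hM d b b' hb hb'
    rw [← Tuple.append_eta d, compBody_sat] at hb hb'
    have ha := (((isFunctional_iff.1 g.rep_functional).2 ⟨M, hM⟩).1 _ _ hb.1).1
    exact (((isFunctional_iff.1 g.rep_functional).2 ⟨M, hM⟩).2 _ ha).unique hb.1 hb'.1
  · obtain ⟨b, hb⟩ := (RForm.sat_exs ..).1 hca
    rw [compBody_sat] at hb
    exact ⟨(((isFunctional_iff.1 g.rep_functional).2 M).1 _ _ hb.1).1,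
      (((isFunctional_iff.1 h.rep_functional).2 M).1 _ _ hb.2).2⟩
  · exact ⟨_, (compForm_sat g h M ⟨a, ha⟩ _).2 rfl,
      fun c hc => ((compForm_sat g h M ⟨a, ha⟩ _).1 hc).symm⟩

theorem idForm_functional (A : SynObj T) : IsFunctional A A (idForm A) := by
  refine isFunctional_iff.2 ⟨idForm_cart A, fun M => ⟨fun b a h => ?_, fun a ha => ?_⟩⟩
  · exact ⟨((idForm_sat ..).1 h).1, ((idForm_sat ..).1 h).2 ▸ ((idForm_sat ..).1 h).1⟩
  · exact ⟨a, (idForm_sat ..).2 ⟨ha, rfl⟩, fun b hb => ((idForm_sat ..).1 hb).2.symm⟩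

noncomputable instance : CategoryStruct (SynObj T) where
  Hom A B := SynHom A B
  id A := (⟦⟨idForm A, idForm_functional A⟩⟧ : Quotient (relSetoid A A))
  comp {A _ C} g h := (⟦⟨compForm g h, compForm_functional g h⟩⟧ : Quotient (relSetoid A C))

theorem app_id (A : SynObj T) (M : Mdl T) (a : M.interp A) :
    (SynHom.app (𝟙 A) M a) = a :=
  Subtype.ext (SynHom.app_mk _ M a _ ((idForm_sat ..).2 ⟨a.2, rfl⟩))

theorem app_comp {A B C : SynObj T} (g : A ⟶ B) (h : B ⟶ C) (M : Mdl T) (a : M.interp A) :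
    SynHom.app (g ≫ h) M a = SynHom.app h M (SynHom.app g M a) :=
  Subtype.ext (SynHom.app_mk _ M a _ ((compForm_sat ..).2 rfl))

/-- The syntactic category of the theory. -/
noncomputable instance : Category (SynObj T) where
  id_comp g := SynHom.ext_app fun M a => by rw [app_comp, app_id]
  comp_id g := SynHom.ext_app fun M a => by rw [app_comp, app_id]
  assoc f g h := SynHom.ext_app fun M a => by simp only [app_comp]

/-- The object `[x⃗ ∣ ⊤]`. -/
abbrev SynObj.free (T : CartTheory L) (Γ : List L.Srt) : SynObj T := ⟨Γ, .top, trivial⟩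

/-- The object `[x⃗ ∣ α]` for an atomic formula `α`. -/
abbrev SynObj.ofAtom (T : CartTheory L) {Γ : List L.Srt} (α : Atom L Γ) : SynObj T :=
  ⟨Γ, .atom α, trivial⟩

/-- The morphism `[x⃗ ∣ φ] ⟶ [x⃗ ∣ ⊤]` given by `φ(x⃗) ∧ x⃗ = x⃗'`. -/
def iota (A : SynObj T) : A ⟶ SynObj.free T A.ctx :=
  (⟦⟨idForm A, by
    refine isFunctional_iff.2 ⟨idForm_cart A, fun M => ⟨fun b a h => ?_, fun a ha => ?_⟩⟩
    · exact ⟨((idForm_sat ..).1 h).1, trivial⟩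
    · exact ⟨a, (idForm_sat ..).2 ⟨ha, rfl⟩, fun b hb => ((idForm_sat ..).1 hb).2.symm⟩⟩⟧ :
    Quotient (relSetoid A (SynObj.free T A.ctx)))

theorem app_iota (A : SynObj T) (M : Mdl T) (a : M.interp A) :
    (SynHom.app (iota A) M a).1 = a.1 :=
  SynHom.app_mk _ M a _ ((idForm_sat ..).2 ⟨a.2, rfl⟩)

/-- The value in `M(s)` of a morphism `[x⃗ ∣ φ] ⟶ [y : s ∣ ⊤]` at an element of `⟦x⃗ ∣ φ⟧_M`. -/
noncomputable def elt {A : SynObj T} {s : L.Srt} (g : A ⟶ SynObj.free T [s]) (M : Mdl T)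
    (a : M.interp A) : M.toStr.carrier s := (SynHom.app g M a).1 s .zero

theorem elt_ext {A : SynObj T} {s : L.Srt} {g g' : A ⟶ SynObj.free T [s]}
    (h : ∀ (M : Mdl T) (a : M.interp A), elt g M a = elt g' M a) : g = g' := by
  refine SynHom.ext_app fun M a => ?_
  funext t v
  rcases v with _ | v
  · exact h M a
  · cases v

theorem elt_iff {A : SynObj T} {s : L.Srt} (g : A ⟶ SynObj.free T [s]) (M : Mdl T)
    (a : M.interp A) (x : M.toStr.carrier s) :
    (SynHom.rep g).Sat M.toStr (Tuple.cons x a.1) ↔ elt g M a = x := by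
  refine (SynHom.app_iff g M a (Tuple.cons x Tuple.nil)).trans ⟨fun h => ?_, fun h => ?_⟩
  · exact congrFun (congrFun h s) .zero
  · funext t v
    rcases v with _ | v
    · exact h
    · cases v

/-- The formula `φ(x⃗) ∧ ⋀ᵢ θᵢ(x⃗, yᵢ)`. -/
noncomputable def tupleForm {A : SynObj T} {Δ : List L.Srt}
    (k : Tuple (fun s => A ⟶ SynObj.free T [s]) Δ) : RForm L (Δ ++ A.ctx) :=
  .and (A.form.subst varsR)
    (.conjVars Δ fun s v => (SynHom.rep (k s v)).subst (Tuple.cons (.var v.inl) varsR))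

theorem tupleForm_sat {A : SynObj T} {Δ : List L.Srt}
    (k : Tuple (fun s => A ⟶ SynObj.free T [s]) Δ) (M : Mdl T)
    (b : Tuple M.toStr.carrier Δ) (a : Tuple M.toStr.carrier A.ctx) :
    (tupleForm k).Sat M.toStr (b.append a) ↔
      ∃ h : A.form.Sat M.toStr a, (fun s v => elt (k s v) M ⟨a, h⟩) = b := by
  have e : ∀ (s : L.Srt) (v : Var Δ s), (fun t (w : Var (s :: A.ctx) t) =>
      ((Tuple.cons (.var v.inl) varsR : Tuple (Term L (Δ ++ A.ctx)) (s :: A.ctx)) t w).eval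
        M.toStr (b.append a)) = Tuple.cons (b s v) a := by
    intro s v; funext t w
    cases w with
    | zero => exact Tuple.append_inl b a v
    | succ w => exact Tuple.append_inr b a w
  have h1 : (A.form.subst varsR).Sat M.toStr (b.append a) ↔ A.form.Sat M.toStr a := by
    rw [RForm.sat_subst, eval_varsR]
  constructor
  · rintro ⟨ha, hk⟩
    refine ⟨h1.1 ha, ?_⟩
    funext s v
    have := (RForm.sat_conjVars ..).1 hk s v
    have := (RForm.sat_subst M.toStr (Γ := s :: A.ctx) _ _ _).1 this
    rw [e] at this
    exact (elt_iff (k s v) M ⟨a, h1.1 ha⟩ _).1 this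
  · rintro ⟨ha, rfl⟩
    refine ⟨h1.2 ha, (RForm.sat_conjVars ..).2 fun s v => ?_⟩
    refine (RForm.sat_subst M.toStr (Γ := s :: A.ctx) _ _ _).2 ?_
    rw [e]
    exact (elt_iff (k s v) M ⟨a, ha⟩ _).2 rfl

theorem tupleForm_cart {A : SynObj T} {Δ : List L.Srt}
    (k : Tuple (fun s => A ⟶ SynObj.free T [s]) Δ) : (tupleForm k).IsCartesian T.axioms :=
  ⟨A.cart.subst _,
    RForm.isCartesian_conjVars _ fun s v => (SynHom.rep_functional (k s v)).cart.subst _⟩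

theorem tupleForm_functional {A : SynObj T} {Δ : List L.Srt}
    (k : Tuple (fun s => A ⟶ SynObj.free T [s]) Δ) :
    IsFunctional A (SynObj.free T Δ) (tupleForm k) := by
  refine isFunctional_iff.2 ⟨tupleForm_cart k, fun M => ⟨fun b a h => ?_, fun a ha => ?_⟩⟩
  · exact ⟨((tupleForm_sat ..).1 h).1, trivial⟩
  · refine ⟨_, (tupleForm_sat ..).2 ⟨ha, rfl⟩, fun b hb => ?_⟩
    exact ((tupleForm_sat ..).1 hb).2.symm

/-- The morphism `[x⃗ ∣ φ] ⟶ [y⃗ ∣ ⊤]` with the given components. -/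
noncomputable def tuple {A : SynObj T} {Δ : List L.Srt}
    (k : Tuple (fun s => A ⟶ SynObj.free T [s]) Δ) : A ⟶ SynObj.free T Δ :=
  (⟦⟨tupleForm k, tupleForm_functional k⟩⟧ : Quotient (relSetoid A (SynObj.free T Δ)))

theorem app_tuple {A : SynObj T} {Δ : List L.Srt} (k : Tuple (fun s => A ⟶ SynObj.free T [s]) Δ)
    (M : Mdl T) (a : M.interp A) :
    (SynHom.app (tuple k) M a).1 = fun s v => elt (k s v) M a :=
  SynHom.app_mk _ M a _ ((tupleForm_sat ..).2 ⟨a.2, rfl⟩)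

theorem comp_tuple {A B : SynObj T} (g : A ⟶ B) {Δ : List L.Srt}
    (k : Tuple (fun s => B ⟶ SynObj.free T [s]) Δ) :
    g ≫ tuple k = tuple fun s v => g ≫ k s v := by
  refine SynHom.ext_app fun M a => ?_
  rw [app_comp, app_tuple, app_tuple]
  funext t v
  change _ = (SynHom.app (g ≫ k t v) M a).1 _ .zero
  rw [app_comp]; rfl

/-- The morphism `[y⃗ ∣ ⊤] ⟶ [z : s ∣ ⊤]` given by `f(y⃗) = z`. -/
def fnHom (T : CartTheory L) {d : List L.Srt} {s : L.Srt} (f : L.Fn d s) :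
    SynObj.free T d ⟶ SynObj.free T [s] :=
  (⟦⟨(.eq (.app f fun _ v => .var v.succ) (.var .zero) : RForm L (s :: d)), by
    refine isFunctional_iff.2 ⟨trivial, fun M => ⟨fun _ _ _ => ⟨trivial, trivial⟩,
      fun a _ => ⟨Tuple.cons (M.toStr.fn f a) Tuple.nil, ?_, fun b hb => ?_⟩⟩⟩
    · exact (rfl : M.toStr.fn f a = M.toStr.fn f a)
    · funext t v
      rcases v with _ | v
      · exact hb.symm
      · cases v⟩⟧ : Quotient (relSetoid (SynObj.free T d) (SynObj.free T [s])))

theorem elt_fnHom {d : List L.Srt} {s : L.Srt} (f : L.Fn d s) (M : Mdl T)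
    (a : M.interp (SynObj.free T d)) : elt (fnHom T f) M a = M.toStr.fn f a.1 :=
  (elt_iff ..).1 ((SynHom.rep_mk ..).2 (rfl : M.toStr.fn f a.1 = M.toStr.fn f a.1))

/-! ### Finitely presentable models -/

/-- The structure underlying `⟨x⃗ ∣ φ⟩`: the structure of the representable functor
`Hom([x⃗ ∣ φ], -)`.  Its elements of sort `s` are the morphisms `[x⃗ ∣ φ] ⟶ [y : s ∣ ⊤]`, and `R`
holds of a tuple when the induced `[x⃗ ∣ φ] ⟶ [y⃗ ∣ ⊤]` factors through `[y⃗ ∣ R(y⃗)]`. -/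
noncomputable def fpStr (A : SynObj T) : Str L where
  carrier s := A ⟶ SynObj.free T [s]
  fn f k := tuple k ≫ fnHom T f
  rl R k := ∃ g : A ⟶ SynObj.ofAtom T (.rel R fun _ v => .var v), g ≫ iota _ = tuple k

theorem eval_fpStr {A : SynObj T} {Δ : List L.Srt} {s : L.Srt} (t : Term L Δ s)
    (k : Tuple (fpStr A).carrier Δ) (M : Mdl T) (a : M.interp A) :
    elt (t.eval (fpStr A) k) M a = t.eval M.toStr fun s v => elt (k s v) M a := by
  induction t with
  | var v => rfl
  | app f ts ih =>
    change (SynHom.app (tuple _ ≫ fnHom T f) M a).1 _ .zero = _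
    rw [app_comp]
    refine (elt_fnHom f M _).trans ?_
    refine (congrArg (M.toStr.fn f) (app_tuple _ M a)).trans ?_
    exact congrArg (M.toStr.fn f) (funext fun t => funext fun v => ih t v)

theorem factors_iff {A : SynObj T} {Δ : List L.Srt} (α : Atom L Δ) (g : A ⟶ SynObj.free T Δ) :
    (∃ g' : A ⟶ SynObj.ofAtom T α, g' ≫ iota _ = g) ↔
      ∀ (M : Mdl T) (a : M.interp A), α.Sat M.toStr (SynHom.app g M a).1 := by
  constructor
  · rintro ⟨g', rfl⟩ M a
    have := (SynHom.app g' M a).2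
    rw [← app_iota, ← app_comp] at this
    exact this
  · intro h
    have hf : IsFunctional A (SynObj.ofAtom T α) (SynHom.rep (B := SynObj.free T Δ) g) := by
      have hg := isFunctional_iff.1 (SynHom.rep_functional g)
      refine isFunctional_iff.2 ⟨hg.1, fun M => ⟨fun b a hb => ?_, (hg.2 M).2⟩⟩
      have ha := ((hg.2 M).1 b a hb).1
      refine ⟨ha, ?_⟩
      have := (SynHom.app_iff g M ⟨a, ha⟩ b).1 hb
      exact this ▸ h M ⟨a, ha⟩
    let g' : A ⟶ SynObj.ofAtom T α :=
      (⟦⟨SynHom.rep (B := SynObj.free T Δ) g, hf⟩⟧ : Quotient (relSetoid A (SynObj.ofAtom T α)))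
    refine ⟨g', SynHom.ext_app fun M a => ?_⟩
    rw [app_comp, app_iota]
    exact SynHom.app_mk _ M a _ ((SynHom.app_iff g M a _).2 rfl)

theorem sat_fpStr {A : SynObj T} {Δ : List L.Srt} (ψ : RForm L Δ) (hψ : ψ.IsCartesian T.axioms)
    (k : Tuple (fpStr A).carrier Δ) :
    ψ.Sat (fpStr A) k ↔
      ∀ (M : Mdl T) (a : M.interp A), ψ.Sat M.toStr fun s v => elt (k s v) M a := by
  induction ψ with
  | atom α =>
    cases α with
    | eq t u =>
      refine ⟨fun h M a => ?_, fun h => elt_ext fun M a => ?_⟩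
      · exact (eval_fpStr t k M a).symm.trans
          ((congrArg (fun z => elt z M a) h).trans (eval_fpStr u k M a))
      · exact (eval_fpStr t k M a).trans ((h M a).trans (eval_fpStr u k M a).symm)
    | rel R ts =>
      refine (factors_iff (.rel R fun _ v => .var v) _).trans
        (forall_congr' fun M => forall_congr' fun a => ?_)
      refine (iff_of_eq (congrArg (M.toStr.rl R) (app_tuple _ M a))).trans ?_
      exact iff_of_eq (congrArg (M.toStr.rl R)
        (funext fun t => funext fun v => eval_fpStr (ts t v) k M a))
  | top => exact ⟨fun _ _ _ => trivial, fun _ => trivial⟩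
  | and φ ψ ih1 ih2 =>
    exact ⟨fun h M a => ⟨(ih1 hψ.1 k).1 h.1 M a, (ih2 hψ.2 k).1 h.2 M a⟩,
      fun h => ⟨(ih1 hψ.1 k).2 fun M a => (h M a).1, (ih2 hψ.2 k).2 fun M a => (h M a).2⟩⟩
  | @ex Δ s ψ ih =>
    have e : ∀ (x : (fpStr A).carrier s) (M : Mdl T) (a : M.interp A),
        (fun t v => elt ((Tuple.cons x k : Tuple (fpStr A).carrier (s :: Δ)) t v) M a) =
          Tuple.cons (elt x M a) fun t v => elt (k t v) M a := by
      intro x M a; funext t v; cases v <;> rfl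
    have hu := (RForm.isCartesian_ex_iff ψ).1 hψ
    constructor
    · rintro ⟨x, hx⟩ M a
      have := (ih hu.1 _).1 hx M a
      rw [e] at this
      exact ⟨_, this⟩
    · intro h
      let χ : RForm L (Δ ++ (s :: A.ctx)) :=
        .and ((tupleForm k).subst (Tuple.append varsL fun _ v => .var v.succ.inr))
          (ψ.subst (Tuple.cons (.var (Var.inr .zero)) varsL))
      have hχ : ∀ (M : Mdl T) (b : Tuple M.toStr.carrier Δ) (x : M.toStr.carrier s)
          (a : Tuple M.toStr.carrier A.ctx), χ.Sat M.toStr (b.append (Tuple.cons x a)) ↔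
            (tupleForm k).Sat M.toStr (b.append a) ∧ ψ.Sat M.toStr (Tuple.cons x b) := by
        intro M b x a
        refine and_congr ?_ ?_
        · rw [RForm.sat_subst, eval_append, eval_varsL]
          simp only [Term.eval, Tuple.append_inr]
          rfl
        · rw [RForm.sat_subst]
          refine iff_of_eq (congrArg _ ?_)
          funext t v
          cases v with
          | zero => exact Tuple.append_inr b (Tuple.cons x a) .zero
          | succ v => exact Tuple.append_inl b (Tuple.cons x a) v
      have hsat : ∀ (M : Mdl T) (b : Tuple M.toStr.carrier [s]) (a : Tuple M.toStr.carrier A.ctx),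
          (RForm.exs Δ χ).Sat M.toStr (Tuple.cons (b s .zero) a) ↔ ∃ ha : A.form.Sat M.toStr a,
            ψ.Sat M.toStr (Tuple.cons (b s .zero) fun t v => elt (k t v) M ⟨a, ha⟩) := by
        intro M b a
        refine (RForm.sat_exs ..).trans ?_
        constructor
        · rintro ⟨c, hc⟩
          obtain ⟨h1, h2⟩ := (hχ M c _ a).1 hc
          obtain ⟨ha, rfl⟩ := (tupleForm_sat k M c a).1 h1
          exact ⟨ha, h2⟩
        · rintro ⟨ha, h2⟩
          exact ⟨_, (hχ M _ _ a).2 ⟨(tupleForm_sat k M _ a).2 ⟨ha, rfl⟩, h2⟩⟩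
      have hf : IsFunctional A (SynObj.free T [s]) (RForm.exs Δ χ) := by
        refine isFunctional_iff.2 ⟨?_, fun M => ⟨fun b a hb => ?_, fun a ha => ?_⟩⟩
        · refine RForm.isCartesian_exs _ ⟨(tupleForm_cart k).subst _, hu.1.subst _⟩ ?_
          intro M hM d b b' hb hb'
          rw [← Tuple.cons_eta d] at hb hb'
          obtain ⟨_, h1⟩ := (tupleForm_sat k ⟨M, hM⟩ _ _).1 ((hχ ⟨M, hM⟩ _ _ _).1 hb).1
          obtain ⟨_, h2⟩ := (tupleForm_sat k ⟨M, hM⟩ _ _).1 ((hχ ⟨M, hM⟩ _ _ _).1 hb').1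
          exact h1.symm.trans h2
        · exact ⟨((hsat M b a).1 hb).1, trivial⟩
        · obtain ⟨x, hx⟩ := h M ⟨a, ha⟩
          refine ⟨Tuple.cons x Tuple.nil, (hsat M (Tuple.cons x Tuple.nil) a).2 ⟨ha, hx⟩,
            fun b hb => ?_⟩
          obtain ⟨_, hb⟩ := (hsat M b a).1 hb
          funext t v
          rcases v with _ | v
          · exact hu.2 M.toStr M.models _ _ _ hb hx
          · cases v
      let g : A ⟶ SynObj.free T [s] :=
        (⟦⟨RForm.exs Δ χ, hf⟩⟧ : Quotient (relSetoid A (SynObj.free T [s])))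
      refine ⟨g, (ih hu.1 _).2 fun M a => ?_⟩
      refine (congrArg (ψ.Sat M.toStr) (e g M a)).mpr ?_
      have h1 : (RForm.exs Δ χ).Sat M.toStr (Tuple.cons (elt g M a) a.1) :=
        (SynHom.rep_mk (A := A) (B := SynObj.free T [s]) ⟨_, hf⟩ M _).1 ((elt_iff g M a _).2 rfl)
      exact ((hsat M (Tuple.cons (elt g M a) Tuple.nil) a.1).1 h1).2

/-- The finitely presentable model `⟨x⃗ ∣ φ⟩`. -/
noncomputable def fp (A : SynObj T) : Mdl T where
  toStr := fpStr A
  models := by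
    obtain ⟨r, -, -, h⟩ := T.isCartesian
    intro q hq k hk
    have hl := (h ⟨q, hq⟩).1.mono (fun p hp => hp.1)
    have hr := (h ⟨q, hq⟩).2.mono (fun p hp => hp.1)
    exact (sat_fpStr q.rhs hr k).2 fun M a =>
      M.models q hq _ ((sat_fpStr q.lhs hl k).1 hk M a)

/-- The homomorphism `⟨y⃗ ∣ ψ⟩ ⟶ ⟨x⃗ ∣ φ⟩` given by precomposition with `[x⃗ ∣ φ] ⟶ [y⃗ ∣ ψ]`. -/
noncomputable def fpMap {A B : SynObj T} (g : A ⟶ B) : fp B ⟶ fp A where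
  toFun s θ := (g ≫ θ : A ⟶ SynObj.free T [s])
  map_fn f k := (Category.assoc g (tuple k) (fnHom T f)).symm.trans
    (congrArg (fun z => z ≫ fnHom T f) (comp_tuple g k))
  map_rl R k := by
    rintro ⟨g', hg'⟩
    refine ⟨g ≫ g', ?_⟩
    rw [Category.assoc, hg']
    exact comp_tuple g k

/-- The homomorphism `⟨x⃗ ∣ φ⟩ ⟶ M` induced by `a⃗ ∈ ⟦x⃗ ∣ φ⟧_M`: it sends a morphism
`θ : [x⃗ ∣ φ] ⟶ [y : s ∣ ⊤]` to `F_M(θ)(a⃗)`. -/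
noncomputable def induced {A : SynObj T} {M : Mdl T} (a : M.interp A) : fp A ⟶ M where
  toFun s θ := elt θ M a
  map_fn f k := by
    change (SynHom.app (tuple k ≫ fnHom T f) M a).1 _ .zero = _
    rw [app_comp]
    exact (elt_fnHom f M _).trans (congrArg (M.toStr.fn f) (app_tuple k M a))
  map_rl R k h := by
    have := (factors_iff (.rel R fun _ v => .var v) (tuple k)).1 h M a
    exact (congrArg (M.toStr.rl R) (app_tuple k M a)).mp this

/-! ### Reflecting homomorphisms and the formulae for embeddings -/

variable (L) in
/-- Atomic formulae-in-context. -/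
abbrev AtomInCtx : Type u := Σ Δ : List L.Srt, Atom L Δ

/-- `h` is `At`-reflecting. -/
def Reflects (At : Set (AtomInCtx L)) {N M : Mdl T} (h : N ⟶ M) : Prop :=
  ∀ p ∈ At, ∀ a : Tuple N.toStr.carrier p.1,
    p.2.Sat M.toStr (a.map (StrHom.toFun h)) → p.2.Sat N.toStr a

/-- `h` is an embedding of structures. -/
def IsEmb {N M : Mdl T} (h : N ⟶ M) : Prop := StrHom.IsEmbedding h

/-- The homomorphism `⟨y⃗ ∣ ⊤⟩ ⟶ ⟨y⃗ ∣ α⟩` corresponding to `[y⃗ ∣ α] ⟶ [y⃗ ∣ ⊤]`. -/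
noncomputable def atomMap (T : CartTheory L) {Δ : List L.Srt} (α : Atom L Δ) :
    fp (SynObj.free T Δ) ⟶ fp (SynObj.ofAtom T α) := fpMap (iota (SynObj.ofAtom T α))

/-- The lifting property of `h` against the homomorphisms `⟨y⃗ ∣ ⊤⟩ ⟶ ⟨y⃗ ∣ α⟩`, for `α ∈ At`. -/
def HasAtLifting (At : Set (AtomInCtx L)) {N M : Mdl T} (h : N ⟶ M) : Prop :=
  ∀ p ∈ At, ∀ (l : fp (SynObj.free T p.1) ⟶ N) (k : fp (SynObj.ofAtom T p.2) ⟶ M),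
    atomMap T p.2 ≫ k = l ≫ h →
      ∃ d : fp (SynObj.ofAtom T p.2) ⟶ N, atomMap T p.2 ≫ d = l

/-- The formula `⋀_{(y⃗, α) ∈ At} ⋀_{θ : [x⃗ ∣ φ] ⟶ [y⃗ ∣ ⊤]} ∀ y⃗, (α(y⃗) ∧ θ(x⃗, y⃗) → ⋁_δ δ(x⃗, y⃗))`,
where `δ` ranges over the morphisms `[x⃗ ∣ φ] ⟶ [y⃗ ∣ α]` through which `θ` factors. -/
noncomputable def atForm (At : Set (AtomInCtx L)) (A : SynObj T) : IForm L A.ctx :=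
  .conj fun p : At => .conj fun θ : A ⟶ SynObj.free T p.1.1 =>
    .alls p.1.1 (.imp
      (RForm.and (.atom (p.1.2.subst varsL)) (SynHom.rep θ)).toIForm
      (.disj fun δ : {δ : A ⟶ SynObj.ofAtom T p.1.2 // δ ≫ iota _ = θ} =>
        (SynHom.rep δ.1).toIForm))

/-- The formula for embeddings with domain `⟨x⃗ ∣ φ⟩`. -/
noncomputable def embForm (A : SynObj T) : IForm L A.ctx := atForm Set.univ A

end CartLogic

/-!
The finitely presentable model `⟨x⃗ ∣ φ⟩` carries a generic tuple: the projections `[x⃗ ∣ φ] ⟶ [y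
: s ∣ ⊤]`. Truth of a cartesian formula in `⟨x⃗ ∣ φ⟩` is truth at every tuple of every model that
satisfies `φ` (`sat_fpStr`), so the generic tuple satisfies `φ`, and an element `θ` is related to
it by the formula `θ`. Homomorphisms preserve regular formulae, hence a homomorphism `f : ⟨x⃗ ∣ φ⟩
⟶ M` sends the generic tuple to a tuple in `⟦x⃗ ∣ φ⟧_M` and is the homomorphism induced by it.
This is the Yoneda lemma (`induced_point`, `point_induced`): homomorphisms `⟨x⃗ ∣ φ⟩ ⟶ M` are the
elements of `⟦x⃗ ∣ φ⟧_M`, and precomposition with `⟨y⃗ ∣ ⊤⟩ ⟶ ⟨y⃗ ∣ α⟩` forgets that the tuple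
satisfies `α`. Under this translation, the lifting property is word for word the reflection of the
atomic formulae.

For the formula defining embeddings, tuples of `⟨x⃗ ∣ φ⟩` of the sorts of `y⃗` are the morphisms
`θ : [x⃗ ∣ φ] ⟶ [y⃗ ∣ ⊤]` (`exists_tuple_eq`), and such a tuple satisfies `α` exactly when `θ`
factors through `[y⃗ ∣ α]` (`atom_sat_fp_iff`). So the formula holds at `a⃗` if and only if the
homomorphism induced by `a⃗` reflects all atomic formulae (`sat_atForm_iff`), which for
homomorphisms of structures amounts to being an embedding (`isEmb_iff_reflects`).
-/

namespace CartLogic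

variable {L : Signature.{u}}

/-! ### Homomorphisms and satisfaction -/

theorem StrHom.eval_map {M N : Str L} (h : StrHom M N) {Γ : List L.Srt} (a : Tuple M.carrier Γ)
    {s : L.Srt} (t : Term L Γ s) : t.eval N (a.map h.toFun) = h.toFun s (t.eval M a) := by
  induction t with
  | var v => rfl
  | app f ts ih =>
    refine Eq.trans ?_ (h.map_fn f _).symm
    exact congrArg (N.fn f) (funext fun t => funext fun v => ih t v)

theorem StrHom.sat_map {M N : Str L} (h : StrHom M N) {Γ : List L.Srt} (φ : RForm L Γ)
    (a : Tuple M.carrier Γ) (hφ : φ.Sat M a) : φ.Sat N (a.map h.toFun) := by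
  induction φ with
  | atom α =>
    cases α with
    | eq t t' =>
      change t.eval N _ = t'.eval N _
      rw [h.eval_map, h.eval_map]
      exact congrArg (h.toFun _) hφ
    | rel R ts =>
      change N.rl R fun s v => (ts s v).eval N _
      simp only [h.eval_map]
      exact h.map_rl R _ hφ
  | top => trivial
  | and φ ψ ih1 ih2 => exact ⟨ih1 a hφ.1, ih2 a hφ.2⟩
  | ex φ ih =>
    obtain ⟨x, hx⟩ := hφ
    exact ⟨h.toFun _ x, Tuple.map_cons h.toFun x a ▸ ih _ hx⟩

theorem RForm.sat_toIForm (M : Str L) {Γ : List L.Srt} (φ : RForm L Γ) (a : Tuple M.carrier Γ) :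
    φ.toIForm.Sat M a ↔ φ.Sat M a := by
  induction φ with
  | atom α => rfl
  | top => exact ⟨fun _ => trivial, fun _ i => nomatch i⟩
  | and φ ψ ih1 ih2 =>
    constructor
    · exact fun h => ⟨(ih1 a).1 (h ⟨true⟩), (ih2 a).1 (h ⟨false⟩)⟩
    · rintro h ⟨_ | _⟩
      · exact (ih2 a).2 h.2
      · exact (ih1 a).2 h.1
  | ex φ ih => exact exists_congr fun x => ih _

theorem IForm.sat_imp (M : Str L) {Γ : List L.Srt} (φ ψ : IForm L Γ) (a : Tuple M.carrier Γ) :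
    (φ.imp ψ).Sat M a ↔ (φ.Sat M a → ψ.Sat M a) := by
  constructor
  · rintro ⟨⟨_ | _⟩, h⟩ hφ
    · exact h
    · exact absurd hφ h
  · intro h
    by_cases hφ : φ.Sat M a
    · exact ⟨⟨false⟩, h hφ⟩
    · exact ⟨⟨true⟩, hφ⟩

theorem IForm.sat_alls (M : Str L) {Γ Δ : List L.Srt} (φ : IForm L (Δ ++ Γ))
    (a : Tuple M.carrier Γ) :
    (IForm.alls Δ φ).Sat M a ↔ ∀ b : Tuple M.carrier Δ, φ.Sat M (b.append a) := by
  induction Δ with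
  | nil => exact ⟨fun h _ => h, fun h => h Tuple.nil⟩
  | cons s Δ ih =>
    exact (ih _).trans ⟨fun h b => h b.tail (b _ .zero), fun h b x => h (Tuple.cons x b)⟩

variable {T : CartTheory L}

/-- Injectivity is the reflection of the equations `y = y'`, and conversely an embedding reflects
all atomic formulae because homomorphisms commute with the evaluation of terms. -/
theorem isEmb_iff_reflects {N M : Mdl T} (h : N ⟶ M) : IsEmb h ↔ Reflects Set.univ h := by
  constructor
  · rintro ⟨hi, hr⟩ ⟨Δ, α⟩ - a hα
    cases α with
    | eq t t' =>
      refine hi _ ?_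
      rw [← StrHom.eval_map h, ← StrHom.eval_map h]
      exact hα
    | rel R ts =>
      refine hr R _ ?_
      change M.toStr.rl R fun s v => (ts s v).eval M.toStr (a.map (StrHom.toFun h)) at hα
      simp only [StrHom.eval_map] at hα
      exact hα
  · intro hh
    refine ⟨fun s x y hxy => ?_, fun {d} R a hR => ?_⟩
    · exact hh ⟨[s, s], .eq (.var .zero) (.var (.succ .zero))⟩ trivial
        (Tuple.cons x (Tuple.cons y Tuple.nil)) hxy
    · exact hh ⟨d, .rel R fun _ v => .var v⟩ trivial a hR

/-! ### Generic tuples -/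

/-- The morphism `[x⃗ ∣ φ] ⟶ [y : s ∣ ⊤]` given by `φ(x⃗) ∧ xᵢ = y`, for a variable `xᵢ` of sort `s`. -/
def proj (A : SynObj T) {s : L.Srt} (v : Var A.ctx s) : A ⟶ SynObj.free T [s] :=
  (⟦⟨(.and (A.form.subst wk) (.eq (.var v.succ) (.var .zero)) : RForm L (s :: A.ctx)), by
    refine isFunctional_iff.2 ⟨⟨A.cart.subst _, trivial⟩, fun M => ⟨fun b a h => ?_,
      fun a ha => ⟨Tuple.cons (a s v) Tuple.nil, ?_, fun b hb => ?_⟩⟩⟩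
    · exact ⟨(RForm.sat_subst ..).1 h.1, trivial⟩
    · exact ⟨(RForm.sat_subst (Δ := s :: A.ctx) ..).2 ha, (rfl : a s v = a s v)⟩
    · funext t w
      rcases w with _ | w
      · exact hb.2.symm
      · cases w⟩⟧ : Quotient (relSetoid A (SynObj.free T [s])))

theorem elt_proj (A : SynObj T) {s : L.Srt} (v : Var A.ctx s) (M : Mdl T) (a : M.interp A) :
    elt (proj A v) M a = a.1 s v :=
  (elt_iff ..).1 ((SynHom.rep_mk ..).2
    ⟨(RForm.sat_subst (Δ := s :: A.ctx) ..).2 a.2, (rfl : a.1 s v = a.1 s v)⟩)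

theorem elt_comp {A B : SynObj T} {s : L.Srt} (g : A ⟶ B) (θ : B ⟶ SynObj.free T [s]) (M : Mdl T)
    (a : M.interp A) : elt (g ≫ θ) M a = elt θ M (SynHom.app g M a) :=
  congrFun (congrFun (congrArg Subtype.val (app_comp g θ M a)) s) .zero

theorem iota_comp_proj (A : SynObj T) {s : L.Srt} (v : Var A.ctx s) :
    iota A ≫ proj (SynObj.free T A.ctx) v = proj A v :=
  elt_ext fun M a => by
    rw [elt_comp, elt_proj, elt_proj]
    exact congrFun (congrFun (app_iota A M a) s) v

theorem exists_tuple_eq {A : SynObj T} {Δ : List L.Srt} (θ : A ⟶ SynObj.free T Δ) :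
    ∃ k : Tuple (fpStr A).carrier Δ, tuple k = θ := by
  refine ⟨fun s v => θ ≫ proj (SynObj.free T Δ) v, SynHom.ext_app fun M a => ?_⟩
  rw [app_tuple]
  funext s v
  rw [elt_comp, elt_proj]

/-- The tuple of projections in `⟨x⃗ ∣ φ⟩`. -/
def generic (A : SynObj T) : Tuple (fp A).toStr.carrier A.ctx := fun _ v => proj A v

theorem sat_generic (A : SynObj T) : A.form.Sat (fp A).toStr (generic A) :=
  (sat_fpStr A.form A.cart _).2 fun M a => by
    simp only [generic, elt_proj]
    exact a.2

/-- Each element of `⟨x⃗ ∣ φ⟩` is definable from the generic tuple by any formula representing it. -/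
theorem sat_rep_generic {A : SynObj T} {s : L.Srt} (θ : A ⟶ SynObj.free T [s]) :
    (SynHom.rep θ).Sat (fp A).toStr (Tuple.cons (A := (fp A).toStr.carrier) θ (generic A)) := by
  refine (sat_fpStr (Δ := s :: A.ctx) _ (SynHom.rep_functional θ).cart _).2 fun M a => ?_
  have e : (fun t w => elt (Tuple.cons (A := (fp A).toStr.carrier) θ (generic A) t w) M a) =
      Tuple.cons (elt θ M a) a.1 := by
    funext t w
    cases w with
    | zero => rfl
    | succ w => exact elt_proj A w M a
  rw [e]
  exact (elt_iff θ M a _).2 rfl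

/-! ### Homomorphisms out of finitely presentable models -/

/-- The element of `⟦x⃗ ∣ φ⟧_M` corresponding to `f : ⟨x⃗ ∣ φ⟩ ⟶ M`: the image of the generic tuple. -/
def point {A : SynObj T} {M : Mdl T} (f : fp A ⟶ M) : M.interp A :=
  ⟨(generic A).map (StrHom.toFun f), StrHom.sat_map f _ _ (sat_generic A)⟩

theorem point_induced {A : SynObj T} {M : Mdl T} (a : M.interp A) :
    point (induced a) = a :=
  Subtype.ext (funext fun _ => funext fun v => elt_proj A v M a)

theorem induced_point {A : SynObj T} {M : Mdl T} (f : fp A ⟶ M) : induced (point f) = f := by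
  refine StrHom.ext (funext fun s => funext fun θ => (elt_iff (M := M) ..).1 ?_)
  have := StrHom.sat_map f _ _ (sat_rep_generic θ)
  rwa [Tuple.map_cons] at this

theorem point_injective {A : SynObj T} {M : Mdl T} {f g : fp A ⟶ M} (h : point f = point g) :
    f = g := by
  rw [← induced_point f, h, induced_point]

theorem point_comp {A : SynObj T} {N M : Mdl T} (f : fp A ⟶ N) (h : N ⟶ M) :
    (point (f ≫ h)).1 = (point f).1.map (StrHom.toFun h) := rfl

theorem point_atomMap_comp {Δ : List L.Srt} (α : Atom L Δ) {M : Mdl T}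
    (k : fp (SynObj.ofAtom T α) ⟶ M) : (point (atomMap T α ≫ k)).1 = (point k).1 :=
  funext fun s => funext fun v =>
    congrArg (StrHom.toFun k s) (iota_comp_proj (SynObj.ofAtom T α) v)

theorem reflects_iff_hasAtLifting (At : Set (AtomInCtx L)) {N M : Mdl T} (h : N ⟶ M) :
    Reflects At h ↔ HasAtLifting At h := by
  constructor
  · intro hh p hp l k hkl
    have e : (point k).1 = (point l).1.map (StrHom.toFun h) := by
      rw [← point_atomMap_comp, hkl, point_comp]
    have hα : p.2.Sat N.toStr (point l).1 := hh p hp _ (e ▸ (point k).2)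
    refine ⟨induced (A := SynObj.ofAtom T p.2) ⟨(point l).1, hα⟩,
      point_injective (Subtype.ext ?_)⟩
    exact (point_atomMap_comp p.2 _).trans (congrArg Subtype.val (point_induced (M := N) _))
  · intro hh p hp a hα
    let b : N.interp (SynObj.free T p.1) := ⟨a, trivial⟩
    let c : M.interp (SynObj.ofAtom T p.2) := ⟨a.map (StrHom.toFun h), hα⟩
    obtain ⟨d, hd⟩ := hh p hp (induced b) (induced c) (point_injective (Subtype.ext (by
      rw [point_atomMap_comp, point_comp, point_induced, point_induced])))
    have e : (point d).1 = a := by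
      rw [← point_atomMap_comp, hd, point_induced]
    exact e ▸ (point d).2

/-! ### The formulae for embeddings -/

theorem atom_sat_fp_iff {A : SynObj T} {Δ : List L.Srt} (α : Atom L Δ)
    (k : Tuple (fpStr A).carrier Δ) :
    α.Sat (fpStr A) k ↔ ∃ δ : A ⟶ SynObj.ofAtom T α, δ ≫ iota _ = tuple k := by
  refine (sat_fpStr (.atom α) trivial k).trans (Iff.trans ?_ (factors_iff α _).symm)
  exact forall_congr' fun M => forall_congr' fun a =>
    iff_of_eq (congrArg (fun b => α.Sat M.toStr b) (app_tuple k M a).symm)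

/-- The disjunct `δ(x⃗, y⃗)` is automatic once `θ` factors through `δ`, so the disjunction only says
that `θ` factors. -/
theorem sat_atForm_iff_factors (At : Set (AtomInCtx L)) (A : SynObj T) (M : Mdl T)
    (a : M.interp A) :
    (atForm At A).Sat M.toStr a.1 ↔ ∀ p ∈ At, ∀ θ : A ⟶ SynObj.free T p.1,
      p.2.Sat M.toStr (SynHom.app θ M a).1 →
        ∃ δ : A ⟶ SynObj.ofAtom T p.2, δ ≫ iota _ = θ := by
  have hα : ∀ (p : AtomInCtx L) (b : Tuple M.toStr.carrier p.1),
      (p.2.subst varsL).Sat M.toStr (b.append a.1) ↔ p.2.Sat M.toStr b := by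
    intro p b
    rw [Atom.sat_subst, eval_varsL]
  constructor
  · intro h p hp θ hθ
    have h1 := (IForm.sat_imp ..).1
      ((IForm.sat_alls ..).1 (h ⟨p, hp⟩ θ) (SynHom.app θ M a).1)
      ((RForm.sat_toIForm ..).2 ⟨(hα p _).2 hθ, (SynHom.app_iff θ M a _).2 rfl⟩)
    obtain ⟨δ, -⟩ := h1
    exact ⟨δ.1, δ.2⟩
  · rintro h ⟨p, hp⟩ θ
    refine (IForm.sat_alls ..).2 fun b => (IForm.sat_imp ..).2 fun hb => ?_
    obtain ⟨h1, h2⟩ := (RForm.sat_toIForm ..).1 hb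
    have e : (SynHom.app θ M a).1 = b := (SynHom.app_iff θ M a b).1 h2
    obtain ⟨δ, hδ⟩ := h p hp θ (e ▸ (hα p b).1 h1)
    refine ⟨⟨δ, hδ⟩, (RForm.sat_toIForm ..).2 ((SynHom.app_iff δ M a b).2 ?_)⟩
    rw [← e, ← hδ, app_comp, app_iota]

theorem sat_atForm_iff (At : Set (AtomInCtx L)) (A : SynObj T) (M : Mdl T) (a : M.interp A) :
    (atForm At A).Sat M.toStr a.1 ↔ Reflects At (induced a) := by
  rw [sat_atForm_iff_factors]
  have e : ∀ {Δ : List L.Srt} (k : Tuple (fpStr A).carrier Δ),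
      (SynHom.app (tuple k) M a).1 = k.map (StrHom.toFun (induced a)) := fun k => app_tuple k M a
  refine forall_congr' fun p => forall_congr' fun _ => ⟨fun h k hk => ?_, fun h θ hθ => ?_⟩
  · exact (atom_sat_fp_iff p.2 k).2 (h (tuple k) ((e k).symm ▸ hk))
  · obtain ⟨k, rfl⟩ := exists_tuple_eq θ
    exact (atom_sat_fp_iff p.2 k).1 (h k (e k ▸ hθ))

end CartLogic

theorem mainTheorem6 {L : CartLogic.Signature.{u}} (T : CartLogic.CartTheory L) :
    (∀ (At : Set (CartLogic.AtomInCtx L)) (N M : CartLogic.Mdl T) (h : N ⟶ M),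
      CartLogic.Reflects At h ↔ CartLogic.HasAtLifting At h) ∧
    (∀ (A : CartLogic.SynObj T) (M : CartLogic.Mdl T) (h : CartLogic.fp A ⟶ M) (a : M.interp A),
      h = CartLogic.induced a →
        (CartLogic.IsEmb h ↔ (CartLogic.embForm A).Sat M.toStr a.1)) := by
  refine ⟨fun At _ _ h => CartLogic.reflects_iff_hasAtLifting At h, ?_⟩
  rintro A M _ a rfl
  exact (CartLogic.isEmb_iff_reflects _).trans (CartLogic.sat_atForm_iff Set.univ A M a).symm
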